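/- Let $F$ be a field of characteristic zero. Algebras over $F$ are not assumed associative or unital. Let $F\{X\}$ be the free nonassociative $F$-algebra on $x_1,x_2,\dots$, let $P_n\subset F\{X\}$ be the space of multilinear polynomials in $x_1,\dots,x_n$, and for an $F$-algebra $A$ let $\mathrm{Id}(A)\subset F\{X\}$ be the ideal of its polynomial identities. Put $$c_n(A)=\dim_F\frac{P_n}{P_n\cap \mathrm{Id}(A)},\qquad \underline{\exp}(A)=\liminf_{n\to\infty}\sqrt[n]{c_n(A)},\qquad \overline{\exp}(A)=\limsup_{n\to\infty}\sqrt[n]{c_n(A)}\quad(\text{in }[0,\infty]),$$ and let $A^\sharp=F\oplus A$ be the algebra obtained from $A$ by adjoining an external unit. For an integer $T\ge 2$ let $B_T$ be the algebra with basis $\{a\}\cup\{b_i, z^i_1,\dots,z^i_T \mid i=1,2,\dots\}$ and multiplication $z^i_j a=z^i_{j+1}$ for $1\le j\le T-1$, $z^i_T b_i=z^{i+1}_1$, all other products of basis elements being zero. For $N\ge 1$ let $Q_N=F[\theta]_0/(\theta^{N+1})$, where $F[\theta]_0$ is the set of polynomials without free term and $(\theta^{N+1})$ is the ideal of $F[\theta]$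 generated by $\theta^{N+1}$. Theorem. For every real $\alpha>1$ there are integers $2\le T_1<N_1<T_2<N_2<\cdots$ such that the algebra $$R_\alpha=\bigoplus_{i\ge 1} B_{T_i}\otimes_F Q_{N_i}$$ satisfies $$\underline{\exp}(R_\alpha)=1,\qquad \overline{\exp}(R_\alpha)=\alpha,\qquad \underline{\exp}(R_\alpha^\sharp)=2,\qquad \alpha\le\overline{\exp}(R_\alpha^\sharp)\le\alpha+1 .$$ -/

import Mathlib

open scoped TensorProduct ENNReal

noncomputable section

namespace PIExp

universe u v

/-! ### Polynomial identities, codimensions and PI-exponents -/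

section Codimension

variable (F : Type u) [Field F]

/-- The letters occurring in a nonassociative word, with multiplicity. -/
def letters : FreeMagma ℕ → Multiset ℕ
  | FreeMagma.of i => {i}
  | FreeMagma.mul v w => letters v + letters w

/-- The monomial of the free nonassociative algebra `F{X}`, `X = {x_0, x_1, …}`,
given by a nonassociative word. -/
def monomial (w : FreeMagma ℕ) : FreeNonUnitalNonAssocAlgebra F ℕ :=
  FreeMagma.lift (FreeNonUnitalNonAssocAlgebra.of F) w

/-- `P_n`: the multilinear polynomials of `F{X}` in the first `n` variables `x_0, …, x_{n-1}`,
that is the span of the words in which each of these variables occurs exactly once and no other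
variable occurs. -/
def multilinear (n : ℕ) : Submodule F (FreeNonUnitalNonAssocAlgebra F ℕ) :=
  Submodule.span F (monomial F '' {w | letters w = Multiset.range n})

variable (A : Type v) [NonUnitalNonAssocRing A] [Module F A] [IsScalarTower F A A]
  [SMulCommClass F A A]

/-- `Id(A)`: the polynomials that vanish under every substitution of elements of `A`
for the variables. -/
def identities : Submodule F (FreeNonUnitalNonAssocAlgebra F ℕ) where
  carrier := {f | ∀ φ : ℕ → A, FreeNonUnitalNonAssocAlgebra.lift F φ f = 0}
  zero_mem' φ := map_zero _
  add_mem' hf hg φ := by rw [map_add, hf φ, hg φ, add_zero]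
  smul_mem' c f hf φ := by rw [map_smul, hf φ, smul_zero]

/-- The codimension `c_n(A) = dim P_n / (P_n ∩ Id(A))`. -/
def codim (n : ℕ) : ℕ :=
  Module.finrank F (multilinear F n ⧸ (identities F A).comap (multilinear F n).subtype)

/-- The lower PI-exponent `liminf c_n(A)^{1/n}`, as an element of `[0, ∞]`. -/
def lowerExp : ℝ≥0∞ :=
  Filter.liminf (fun n : ℕ => (codim F A n : ℝ≥0∞) ^ (1 / (n : ℝ))) Filter.atTop

/-- The upper PI-exponent `limsup c_n(A)^{1/n}`, as an element of `[0, ∞]`; it is finite exactly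
when the codimensions are exponentially bounded. -/
def upperExp : ℝ≥0∞ :=
  Filter.limsup (fun n : ℕ => (codim F A n : ℝ≥0∞) ^ (1 / (n : ℝ))) Filter.atTop

end Codimension

/-! ### Adjoining an external unit

`A^♯ = F ⊕ A` is `Unitization F A`; for a nonassociative `A` we supply the compatibility of its
product with scalars. -/

section Unit

variable (F : Type u) [Field F]
variable (A : Type v) [NonUnitalNonAssocRing A] [Module F A]

instance unitization_isScalarTower [IsScalarTower F A A] :
    IsScalarTower F (Unitization F A) (Unitization F A) where
  smul_assoc r x y := by
    refine Unitization.ext ?_ ?_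
    · simp [mul_assoc]
    · simp [smul_smul, smul_mul_assoc, mul_comm]

instance unitization_smulCommClass [SMulCommClass F A A] :
    SMulCommClass F (Unitization F A) (Unitization F A) where
  smul_comm r x y := by
    refine Unitization.ext ?_ ?_
    · simp [mul_left_comm]
    · simp [smul_smul, mul_smul_comm, mul_comm]

end Unit

/-! ### The algebras `B_T` -/

/-- The basis of `B_T`: elements `a`, `b_i` and `z_j^i` with `i ∈ ℕ`, where the lower index
`j` runs through `0, …, T - 1`. -/
inductive BBasis (T : ℕ) : Type
  | a : BBasis T
  | b (i : ℕ) : BBasis T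
  | z (i : ℕ) (j : Fin T) : BBasis T

/-- The vector space with basis `BBasis T`. It is a type of its own, so that the
pointwise product of finitely supported functions is not in force on it. -/
def BAlg (F : Type u) [Field F] (T : ℕ) : Type u := BBasis T →₀ F

namespace BAlg

variable (F : Type u) [Field F] (T : ℕ)

instance : AddCommGroup (BAlg F T) := inferInstanceAs (AddCommGroup (BBasis T →₀ F))

instance : Module F (BAlg F T) := inferInstanceAs (Module F (BBasis T →₀ F))

/-- The basis vectors. -/
def e (s : BBasis T) : BAlg F T := Finsupp.single s (1 : F)

/-- The multiplication table of `B_T`: `z_j^i a = z_{j+1}^i` if `j` is not the last index,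
`z_j^i b_i = z_0^{i+1}` if `j` is the last index; all other products of basis elements are zero. -/
def table : BBasis T → BBasis T → BAlg F T
  | .z i j, .a => if h : (j : ℕ) + 1 < T then e F T (.z i ⟨(j : ℕ) + 1, h⟩) else 0
  | .z i j, .b k => if (j : ℕ) + 1 = T ∧ k = i then e F T (.z (i + 1) ⟨0, j.pos⟩) else 0
  | _, _ => 0

/-- The bilinear extension of the multiplication table. -/
def mulBilin : BAlg F T →ₗ[F] BAlg F T →ₗ[F] BAlg F T :=
  Finsupp.linearCombination F fun s =>
    (Finsupp.linearCombination F fun t => table F T s t : (BBasis T →₀ F) →ₗ[F] BAlg F T)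

instance : Mul (BAlg F T) := ⟨fun x y => mulBilin F T x y⟩

theorem mul_def (x y : BAlg F T) : x * y = mulBilin F T x y := rfl

theorem e_mul_e (s t : BBasis T) : e F T s * e F T t = table F T s t := by
  rw [mul_def, mulBilin, e, e]
  erw [Finsupp.linearCombination_single, one_smul, Finsupp.linearCombination_single, one_smul]

instance : NonUnitalNonAssocRing (BAlg F T) :=
  { (inferInstance : AddCommGroup (BAlg F T)), (inferInstance : Mul (BAlg F T)) with
    left_distrib := fun x y z => by simp only [mul_def, map_add]
    right_distrib := fun x y z => by simp only [mul_def, map_add, LinearMap.add_apply]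
    zero_mul := fun x => by simp only [mul_def, map_zero, LinearMap.zero_apply]
    mul_zero := fun x => by simp only [mul_def, map_zero] }

instance : IsScalarTower F (BAlg F T) (BAlg F T) where
  smul_assoc r x y := by simp only [smul_eq_mul, mul_def, map_smul, LinearMap.smul_apply]

instance : SMulCommClass F (BAlg F T) (BAlg F T) where
  smul_comm r x y := by simp only [smul_eq_mul, mul_def, map_smul]

end BAlg

/-! ### The algebras `Q_N` and `R` -/

section Construction

variable (F : Type u) [Field F]

open Polynomial in
/-- `Q_N = F[θ]_0 / (θ^{N+1})`: the cosets in `F[θ] / (θ^{N+1})` of the polynomials without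
free term. -/
def QAlg (N : ℕ) : NonUnitalSubalgebra F (F[X] ⧸ Ideal.span {(X : F[X]) ^ (N + 1)}) where
  carrier := {q | ∃ f : F[X], f.coeff 0 = 0 ∧ Ideal.Quotient.mk _ f = q}
  zero_mem' := ⟨0, by simp, map_zero _⟩
  add_mem' := by
    rintro _ _ ⟨f, hf, rfl⟩ ⟨g, hg, rfl⟩
    exact ⟨f + g, by simp [hf, hg], map_add _ _ _⟩
  mul_mem' := by
    rintro _ _ ⟨f, hf, rfl⟩ ⟨g, hg, rfl⟩
    exact ⟨f * g, by simp [hf, mul_coeff_zero], map_mul _ _ _⟩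
  smul_mem' := by
    rintro c _ ⟨f, hf, rfl⟩
    exact ⟨c • f, by simp [hf], rfl⟩

/-- `B(T, N) = B_T ⊗ Q_N`. -/
def BQ (T N : ℕ) : Type u := BAlg F T ⊗[F] QAlg F N

instance (T N : ℕ) : NonUnitalNonAssocRing (BQ F T N) :=
  inferInstanceAs (NonUnitalNonAssocRing (BAlg F T ⊗[F] QAlg F N))

instance (T N : ℕ) : Module F (BQ F T N) :=
  inferInstanceAs (Module F (BAlg F T ⊗[F] QAlg F N))

instance (T N : ℕ) : IsScalarTower F (BQ F T N) (BQ F T N) :=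
  inferInstanceAs (IsScalarTower F (BAlg F T ⊗[F] QAlg F N) (BAlg F T ⊗[F] QAlg F N))

instance (T N : ℕ) : SMulCommClass F (BQ F T N) (BQ F T N) :=
  inferInstanceAs (SMulCommClass F (BAlg F T ⊗[F] QAlg F N) (BAlg F T ⊗[F] QAlg F N))

instance pi_smulCommClass (P : ℕ → Type u) [∀ i, NonUnitalNonAssocRing (P i)]
    [∀ i, Module F (P i)] [∀ i, SMulCommClass F (P i) (P i)] :
    SMulCommClass F (∀ i, P i) (∀ i, P i) where
  smul_comm r x y := funext fun i => smul_comm r (x i) (y i)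

/-- The direct sum `P_0 ⊕ P_1 ⊕ ⋯` of a sequence of algebras, with componentwise operations: the
families of elements `f_i ∈ P_i` with only finitely many nonzero components. -/
def directSum (P : ℕ → Type u) [∀ i, NonUnitalNonAssocRing (P i)] [∀ i, Module F (P i)] :
    NonUnitalSubalgebra F (∀ i, P i) where
  carrier := {f | {i | f i ≠ 0}.Finite}
  zero_mem' := by simp
  add_mem' := by
    intro f g hf hg
    refine (hf.union hg).subset fun i hi => ?_
    by_contra h
    have h' : f i = 0 ∧ g i = 0 := by
      constructor
      · by_contra h1
        exact h (Or.inl h1)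
      · by_contra h1
        exact h (Or.inr h1)
    exact hi (by simp [h'.1, h'.2])
  mul_mem' := by
    intro f g hf _
    refine Set.Finite.subset hf fun i hi h => hi ?_
    simp [h]
  smul_mem' := by
    intro c f hf
    refine Set.Finite.subset hf fun i hi h => hi ?_
    simp [h]

/-- The algebra `R = B(T_0, N_0) ⊕ B(T_1, N_1) ⊕ ⋯`. -/
def RAlg (T N : ℕ → ℕ) : Type u := directSum F fun i => BQ F (T i) (N i)

instance (T N : ℕ → ℕ) : NonUnitalNonAssocRing (RAlg F T N) :=
  inferInstanceAs (NonUnitalNonAssocRing (directSum F fun i => BQ F (T i) (N i)))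

instance (T N : ℕ → ℕ) : Module F (RAlg F T N) :=
  inferInstanceAs (Module F (directSum F fun i => BQ F (T i) (N i)))

instance (T N : ℕ → ℕ) : IsScalarTower F (RAlg F T N) (RAlg F T N) :=
  inferInstanceAs (IsScalarTower F (directSum F fun i => BQ F (T i) (N i))
    (directSum F fun i => BQ F (T i) (N i)))

instance (T N : ℕ → ℕ) : SMulCommClass F (RAlg F T N) (RAlg F T N) :=
  inferInstanceAs (SMulCommClass F (directSum F fun i => BQ F (T i) (N i))
    (directSum F fun i => BQ F (T i) (N i)))

end Construction

end PIExp

end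

/-!
The polynomials of degree `n` that are not identities are counted by linear functionals.

*The algebra `B_T`.* As `x (y t) = 0` holds in `B_T`, only left-normed words matter, and a
multilinear `f` is described by its coefficients at the words `x_{σ 0} x_{σ 1} ⋯ x_{σ (n - 1)}`.
A substitution of basis elements gives such a word a nonzero value only if `x_{σ 0}` goes to some
`z_j^i`, the variables in the positions `r` with `T ∣ j + r` go to successive `b_k`, and all others
go to `a`. The value therefore depends only on the variables in these "key positions", and `f` is an
identity as soon as, for each `j < T`, the sums of its coefficients over all words with prescribed
variables in the key positions vanish (`mem_identities_BAlg`). There are about `n / T` key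
positions, so `c_n(B_T)` equals `n.descFactorial ((n - 1) / T + 1)` up to a polynomial factor. This
is at most `n ^ 3` for `n ≤ T`, with functionals that do not depend on `T`, and it grows faster than
every exponential when `T` is fixed.

*The direct sum.* Tensoring with `Q_N` keeps the multilinear identities of degree `n ≤ N` and makes
everything of larger degree an identity. So in degree `n` the identities of `R` are those of
the `B_{T_i}` with `n ≤ N_i` (`mem_identities_RAlg_iff_of_multilinear`). Given `N_{i-1}`, choose
`T_i` so large that `α ^ N_{i-1} ≤ T_i`, and let `N_i` be the last degree before the upper bound for
`c_n(B_{T_i})` exceeds `α ^ n`. Then `c_n(R) ≤ n ^ 3 + α ^ n` throughout, `c_n(R)` is `α ^ n` up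
to a polynomial factor at `n = N_i`, and `c_j(R) ≤ 2 n ^ 3` for all `j ≤ n = T_{i+1}`.

*The external unit.* A multilinear `f` is an identity of `A^♯` if and only if every polynomial that
arises from it by substituting `1` for some variables is an identity of `A`. Hence
`c_n(A^♯) ≤ 1 + ∑ k, (n choose k) c_k(A)`, which yields the upper bounds `2` (along `n = T_i`) and
`α + 1`. Conversely `c_n(R^♯) ≥ 2 ^ (n - 1)`: on words obtained from one variable by
multiplication with the others on the right (variables in `U`) or on the left, the
substitutions of a `z`, of `a` for the variables in `Y`, and of `1` for the rest have the incidence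
matrix of `Y ⊆ U`.
-/

noncomputable section

namespace PIExp

/-! ### Multilinear polynomials and codimensions -/

section General

universe u v

open FreeNonUnitalNonAssocAlgebra (lift)

@[simp]
theorem letters_of (i : ℕ) : letters (FreeMagma.of i) = {i} := rfl

@[simp]
theorem letters_mul (v w : FreeMagma ℕ) : letters (v * w) = letters v + letters w := rfl

theorem letters_ne_zero (w : FreeMagma ℕ) : letters w ≠ 0 := by
  induction w with
  | ih1 i => simp
  | ih2 v w hv hw => simp [hv]

theorem finite_setOf_letters_eq (s : Multiset ℕ) : {w | letters w = s}.Finite := by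
  have key : ∀ k : ℕ, {w | letters w ≤ s ∧ Multiset.card (letters w) ≤ k}.Finite := by
    intro k
    induction k with
    | zero =>
      refine Set.Finite.subset Set.finite_empty fun w hw => ?_
      exact letters_ne_zero w (Multiset.card_eq_zero.1 (Nat.le_zero.1 hw.2))
    | succ k ih =>
      refine Set.Finite.subset ((s.toFinset.finite_toSet.image FreeMagma.of).union
        (Set.Finite.image2 (fun v w => v * w) ih ih)) ?_
      rintro (i | ⟨v, w⟩) ⟨h1, h2⟩
      · left
        refine ⟨i, ?_, rfl⟩
        simpa [letters] using h1
      · right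
        simp only [letters, Multiset.card_add] at h1 h2
        have hv := Multiset.card_pos.2 (letters_ne_zero v)
        have hw := Multiset.card_pos.2 (letters_ne_zero w)
        exact ⟨v, ⟨le_trans (Multiset.le_add_right _ _) h1, by omega⟩, w,
          ⟨le_trans (Multiset.le_add_left _ _) h1, by omega⟩, rfl⟩
  exact (key (Multiset.card s)).subset fun w hw => ⟨le_of_eq hw, by rw [hw]⟩

variable {F : Type u} [Field F]

@[simp]
theorem monomial_of (i : ℕ) :
    monomial F (FreeMagma.of i) = FreeNonUnitalNonAssocAlgebra.of F i := rfl

@[simp]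
theorem monomial_mul (v w : FreeMagma ℕ) :
    monomial F (v * w) = monomial F v * monomial F w := map_mul _ _ _

theorem monomial_eq_single (w : FreeMagma ℕ) : monomial F w = MonoidAlgebra.single w 1 := by
  induction w with
  | ih1 i => rfl
  | ih2 v w hv hw => rw [monomial_mul, hv, hw, MonoidAlgebra.single_mul_single, one_mul]

theorem monomial_mem_multilinear {n : ℕ} {w : FreeMagma ℕ} (hw : letters w = Multiset.range n) :
    monomial F w ∈ multilinear F n :=
  Submodule.subset_span ⟨w, hw, rfl⟩

instance (n : ℕ) : Module.Finite F (multilinear F n) :=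
  Module.Finite.span_of_finite F ((finite_setOf_letters_eq _).image _)

theorem linearMap_eq_of_mem_multilinear {M : Type*} [AddCommGroup M] [Module F M]
    {L L' : FreeNonUnitalNonAssocAlgebra F ℕ →ₗ[F] M} {n : ℕ}
    (h : ∀ w, letters w = Multiset.range n → L (monomial F w) = L' (monomial F w))
    {f : FreeNonUnitalNonAssocAlgebra F ℕ} (hf : f ∈ multilinear F n) : L f = L' f := by
  refine LinearMap.eqOn_span (s := monomial F '' {w | letters w = Multiset.range n}) ?_ hf
  rintro _ ⟨w, hw, rfl⟩
  exact h w hw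

theorem multilinear_zero : multilinear F 0 = ⊥ := by
  rw [multilinear, Submodule.span_eq_bot]
  rintro _ ⟨w, hw, rfl⟩
  exact absurd hw (letters_ne_zero w)

variable {A : Type v} [NonUnitalNonAssocRing A] [Module F A] [IsScalarTower F A A]
  [SMulCommClass F A A]

@[simp]
theorem lift_monomial (φ : ℕ → A) (w : FreeMagma ℕ) :
    lift F φ (monomial F w) = FreeMagma.lift φ w := by
  induction w with
  | ih1 i => simp
  | ih2 v w hv hw => rw [monomial_mul, map_mul, map_mul, hv, hw]

theorem freeMagma_lift_congr {M : Type*} [Mul M] {φ ψ : ℕ → M} {w : FreeMagma ℕ}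
    (h : ∀ x ∈ letters w, φ x = ψ x) : FreeMagma.lift φ w = FreeMagma.lift ψ w := by
  induction w with
  | ih1 i => simpa using h
  | ih2 v w hv hw =>
    simp only [letters_mul, Multiset.mem_add] at h
    rw [map_mul, map_mul, hv fun x hx => h x (Or.inl hx), hw fun x hx => h x (Or.inr hx)]

theorem lift_congr {n : ℕ} {f : FreeNonUnitalNonAssocAlgebra F ℕ} (hf : f ∈ multilinear F n)
    {φ ψ : ℕ → A} (h : ∀ x < n, φ x = ψ x) : lift F φ f = lift F ψ f := by
  refine linearMap_eq_of_mem_multilinear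
    (L := (lift F φ : FreeNonUnitalNonAssocAlgebra F ℕ →ₗ[F] A))
    (L' := (lift F ψ : FreeNonUnitalNonAssocAlgebra F ℕ →ₗ[F] A)) (fun w hw => ?_) hf
  simp only [LinearMap.coe_coe, lift_monomial]
  exact freeMagma_lift_congr fun x hx => h x (by simpa [hw] using hx)

/-- A word is a linear function of the value substituted for a letter that occurs in it exactly
once. -/
theorem exists_linearMap_lift_update_word (φ : ℕ → A) (x : ℕ) (w : FreeMagma ℕ)
    (hw : (letters w).count x = 1) :
    ∃ L : A →ₗ[F] A, ∀ a, FreeMagma.lift (Function.update φ x a) w = L a := by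
  have hconst : ∀ w : FreeMagma ℕ, (letters w).count x = 0 → ∀ a,
      FreeMagma.lift (Function.update φ x a) w = FreeMagma.lift φ w := by
    intro w hw a
    refine freeMagma_lift_congr fun y hy => Function.update_of_ne ?_ _ _
    rintro rfl
    exact Multiset.count_eq_zero.1 hw hy
  induction w with
  | ih1 i =>
    have : x = i := by
      by_contra hne
      simp [hne] at hw
    subst this
    exact ⟨LinearMap.id, fun a => by simp⟩
  | ih2 v w hv hw' =>
    rw [letters_mul, Multiset.count_add] at hw
    rcases Nat.add_eq_one_iff.1 hw with ⟨h0, h1⟩ | ⟨h1, h0⟩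
    · obtain ⟨L, hL⟩ := hw' h1
      exact ⟨LinearMap.mulLeft F (FreeMagma.lift φ v) ∘ₗ L,
        fun a => by simp [hconst v h0, hL]⟩
    · obtain ⟨L, hL⟩ := hv h1
      exact ⟨LinearMap.mulRight F (FreeMagma.lift φ w) ∘ₗ L,
        fun a => by simp [hconst w h0, hL]⟩

theorem exists_linearMap_lift_update {n : ℕ} {f : FreeNonUnitalNonAssocAlgebra F ℕ}
    (hf : f ∈ multilinear F n) (φ : ℕ → A) {x : ℕ} (hx : x < n) :
    ∃ L : A →ₗ[F] A, ∀ a, lift F (Function.update φ x a) f = L a := by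
  induction hf using Submodule.span_induction with
  | mem f hf =>
    obtain ⟨w, hw, rfl⟩ := hf
    simp only [lift_monomial]
    refine exists_linearMap_lift_update_word φ x w ?_
    rw [Set.mem_ofPred_eq] at hw
    rw [hw]
    exact Multiset.count_eq_one_of_mem (Multiset.nodup_range n) (Multiset.mem_range.2 hx)
  | zero => exact ⟨0, fun a => by simp⟩
  | add f g _ _ hf hg =>
    obtain ⟨L, hL⟩ := hf
    obtain ⟨L', hL'⟩ := hg
    exact ⟨L + L', fun a => by simp [hL, hL']⟩
  | smul c f _ hf =>
    obtain ⟨L, hL⟩ := hf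
    exact ⟨c • L, fun a => by simp [hL]⟩

/-- A multilinear polynomial is an identity as soon as it vanishes on a spanning set. -/
theorem mem_identities_of_span {n : ℕ} {f : FreeNonUnitalNonAssocAlgebra F ℕ}
    (hf : f ∈ multilinear F n) {S : Set A} (hS : Submodule.span F S = ⊤)
    (h : ∀ φ : ℕ → A, (∀ x < n, φ x ∈ S) → lift F φ f = 0) : f ∈ identities F A := by
  -- The variables are freed one after the other from the condition to take values in `S`.
  have key : ∀ k ≤ n, ∀ φ : ℕ → A, (∀ x, k ≤ x → x < n → φ x ∈ S) → lift F φ f = 0 := by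
    intro k
    induction k with
    | zero => exact fun _ φ hφ => h φ fun x hx => hφ x (Nat.zero_le x) hx
    | succ k ih =>
      intro hk φ hφ
      obtain ⟨L, hL⟩ := exists_linearMap_lift_update hf φ (Nat.lt_of_succ_le hk)
      have hL0 : L = 0 := by
        refine LinearMap.ext_on hS fun a ha => ?_
        rw [← hL, LinearMap.zero_apply]
        refine ih (by omega) _ fun x hx hxn => ?_
        rcases eq_or_ne x k with rfl | hne
        · simpa using ha
        · rw [Function.update_of_ne hne]
          exact hφ x (by omega) hxn
      have := hL (φ k)
      rwa [Function.update_eq_self, hL0, LinearMap.zero_apply] at this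
  exact fun φ => key n le_rfl φ fun x hx hxn => by omega

/-- Upper bounds for codimensions: linear conditions that force a polynomial to be an identity. -/
theorem codim_le_finrank {n : ℕ} {M : Type*} [AddCommGroup M] [Module F M] [Module.Finite F M]
    (L : multilinear F n →ₗ[F] M)
    (h : ∀ f : multilinear F n, L f = 0 → (f : FreeNonUnitalNonAssocAlgebra F ℕ) ∈ identities F A) :
    codim F A n ≤ Module.finrank F M := by
  have hle : LinearMap.ker L ≤ (identities F A).comap (multilinear F n).subtype :=
    fun f hf => h f hf
  calc codim F A n ≤ Module.finrank F (multilinear F n ⧸ LinearMap.ker L) :=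
        LinearMap.finrank_le_finrank_of_surjective (Submodule.factor_surjective hle)
    _ = Module.finrank F (LinearMap.range L) := LinearEquiv.finrank_eq L.quotKerEquivRange
    _ ≤ Module.finrank F M := Submodule.finrank_le _

/-- Lower bounds for codimensions: polynomials that are linearly independent modulo identities. -/
theorem card_le_codim {n : ℕ} {ι : Type*} [Fintype ι] (v : ι → FreeNonUnitalNonAssocAlgebra F ℕ)
    (hv : ∀ i, v i ∈ multilinear F n)
    (h : ∀ c : ι → F, ∑ i, c i • v i ∈ identities F A → ∀ i, c i = 0) :
    Fintype.card ι ≤ codim F A n := by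
  have hli : LinearIndependent F fun i : ι =>
      ((identities F A).comap (multilinear F n).subtype).mkQ ⟨v i, hv i⟩ := by
    rw [Fintype.linearIndependent_iff]
    intro c hc
    refine h c ?_
    simp only [← map_smul, ← map_sum] at hc
    rw [Submodule.mkQ_apply, Submodule.Quotient.mk_eq_zero, Submodule.mem_comap] at hc
    simpa using hc
  exact hli.fintype_card_le_finrank

theorem codim_mono {B : Type*} [NonUnitalNonAssocRing B] [Module F B] [IsScalarTower F B B]
    [SMulCommClass F B B] {n : ℕ}
    (h : ∀ f ∈ multilinear F n, f ∈ identities F B → f ∈ identities F A) :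
    codim F A n ≤ codim F B n :=
  LinearMap.finrank_le_finrank_of_surjective (Submodule.factor_surjective
    (fun f hf => h f f.2 hf : (identities F B).comap (multilinear F n).subtype ≤
      (identities F A).comap (multilinear F n).subtype))

theorem codim_zero : codim F A 0 = 0 := by
  refine Nat.le_zero.1 ((Submodule.finrank_quotient_le _).trans ?_)
  rw [multilinear_zero, finrank_bot]

end General

/-! ### Left-normed words -/

section Words

/-- The left-normed word `(…((x_{g 0} x_{g 1}) x_{g 2}) …) x_{g k}` with `k + 1` letters. -/
def leftWord (g : ℕ → ℕ) : ℕ → FreeMagma ℕ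
  | 0 => FreeMagma.of (g 0)
  | k + 1 => leftWord g k * FreeMagma.of (g (k + 1))

theorem letters_leftWord (g : ℕ → ℕ) (k : ℕ) :
    letters (leftWord g k) = (Multiset.range (k + 1)).map g := by
  induction k with
  | zero => rfl
  | succ k ih =>
    rw [leftWord, letters_mul, ih, Multiset.range_succ (k + 1), Multiset.map_cons, letters_of,
      add_comm, Multiset.singleton_add]

theorem leftWord_congr {g h : ℕ → ℕ} {k : ℕ} (H : ∀ r ≤ k, g r = h r) :
    leftWord g k = leftWord h k := by
  induction k with
  | zero => rw [leftWord, leftWord, H 0 le_rfl]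
  | succ k ih => rw [leftWord, leftWord, ih fun r hr => H r (by omega), H (k + 1) le_rfl]

theorem leftWord_injective {g h : ℕ → ℕ} {k : ℕ} (H : leftWord g k = leftWord h k) :
    ∀ r ≤ k, g r = h r := by
  induction k with
  | zero =>
    intro r hr
    obtain rfl := Nat.le_zero.1 hr
    injection H
  | succ k ih =>
    injection H with h1 h2
    injection h2 with h2
    intro r hr
    rcases Nat.lt_or_ge k r with hk | hk
    · obtain rfl : r = k + 1 := by omega
      exact h2
    · exact ih h1 r hk

/-- A permutation of `{0, …, n - 1}` as a function on `ℕ`, extended by `0`. -/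
def permFun {n : ℕ} (σ : Equiv.Perm (Fin n)) (r : ℕ) : ℕ :=
  if h : r < n then (σ ⟨r, h⟩ : ℕ) else 0

/-- The multilinear left-normed word `x_{σ 0} x_{σ 1} ⋯ x_{σ (n - 1)}`; it is meaningful
for `n ≥ 1`. -/
def permWord {n : ℕ} (σ : Equiv.Perm (Fin n)) : FreeMagma ℕ := leftWord (permFun σ) (n - 1)

theorem permFun_of_lt {n : ℕ} (σ : Equiv.Perm (Fin n)) {r : ℕ} (h : r < n) :
    permFun σ r = σ ⟨r, h⟩ := dif_pos h

theorem letters_permWord {n : ℕ} (hn : 0 < n) (σ : Equiv.Perm (Fin n)) :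
    letters (permWord σ) = Multiset.range n := by
  rw [permWord, letters_leftWord, Nat.sub_add_cancel hn]
  have hinj : Set.InjOn (permFun σ) (Finset.range n) := by
    intro r hr t ht h
    rw [Finset.coe_range, Set.mem_Iio] at hr ht
    rw [permFun_of_lt σ hr, permFun_of_lt σ ht] at h
    simpa using σ.injective (Fin.ext h)
  have himage : (Finset.range n).image (permFun σ) = Finset.range n := by
    refine Finset.eq_of_subset_of_card_le (fun x hx => ?_)
      (Finset.card_image_of_injOn hinj).ge
    obtain ⟨r, hr, rfl⟩ := Finset.mem_image.1 hx
    rw [permFun_of_lt σ (Finset.mem_range.1 hr)]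
    exact Finset.mem_range.2 (σ _).2
  rw [← Finset.range_val, ← Finset.image_val_of_injOn hinj, himage]

theorem permWord_injective {n : ℕ} : Function.Injective (permWord (n := n)) := by
  intro σ τ h
  ext i
  have := leftWord_injective h i (by omega)
  rwa [permFun_of_lt σ i.2, permFun_of_lt τ i.2] at this

theorem exists_eq_permWord {n k : ℕ} {g : ℕ → ℕ}
    (h : letters (leftWord g k) = Multiset.range n) :
    ∃ σ : Equiv.Perm (Fin n), leftWord g k = permWord σ := by
  rw [letters_leftWord] at h
  obtain rfl : k + 1 = n := by simpa using congrArg Multiset.card h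
  have hlt : ∀ r < k + 1, g r < k + 1 := fun r hr => by
    rw [← Multiset.mem_range, ← h]
    exact Multiset.mem_map_of_mem g (Multiset.mem_range.2 hr)
  have hinj := Multiset.inj_on_of_nodup_map (by rw [h]; exact Multiset.nodup_range _ :
    ((Multiset.range (k + 1)).map g).Nodup)
  have hσ : Function.Injective fun i : Fin (k + 1) => (⟨g i, hlt i i.2⟩ : Fin (k + 1)) :=
    fun i j hij => Fin.ext (hinj i (Multiset.mem_range.2 i.2) j (Multiset.mem_range.2 j.2)
      (congrArg Fin.val hij))
  refine ⟨Equiv.ofBijective _ (Finite.injective_iff_bijective.1 hσ), leftWord_congr ?_⟩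
  intro r hr
  rw [permFun_of_lt _ (Nat.lt_succ_of_le hr)]
  rfl

end Words

/-! ### Evaluation of words in `B_T` -/

section Evaluation

universe u

variable {F : Type u} [Field F] {T : ℕ}

/-- The elements `z_j^i` in the order `z_0^0, …, z_{T-1}^0, z_0^1, …` in which right
multiplication runs through them. -/
def zState (hT : 0 < T) (N : ℕ) : BBasis T := .z (N / T) ⟨N % T, Nat.mod_lt _ hT⟩

/-- The only basis element by which the `N`-th `z` can be multiplied with a nonzero result. -/
def nextLetter (T N : ℕ) : BBasis T := if T ∣ N + 1 then .b (N / T) else .a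

theorem z_eq_zState (hT : 0 < T) (i : ℕ) (j : Fin T) : .z i j = zState hT (i * T + j) := by
  rw [zState]
  congr 1
  · rw [mul_comm, Nat.mul_add_div hT, Nat.div_eq_of_lt j.2, add_zero]
  · refine Fin.ext ?_
    rw [mul_comm]
    exact ((Nat.mul_add_mod _ _ _).trans (Nat.mod_eq_of_lt j.2)).symm

theorem e_ne_zero (s : BBasis T) : BAlg.e F T s ≠ 0 :=
  Finsupp.single_ne_zero.2 one_ne_zero

theorem nextLetter_ne_z (N i : ℕ) (j : Fin T) : nextLetter T N ≠ .z i j := by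
  rw [nextLetter]
  split_ifs <;> simp

theorem dvd_succ_iff_mod (hT : 0 < T) (N : ℕ) : T ∣ N + 1 ↔ N % T + 1 = T := by
  have h1 := Nat.mod_lt N hT
  rw [Nat.dvd_iff_mod_eq_zero, ← Nat.mod_add_mod]
  constructor
  · intro h
    by_contra hne
    rw [Nat.mod_eq_of_lt (by omega)] at h
    omega
  · intro h
    rw [h, Nat.mod_self]

theorem div_mod_succ (hT : 0 < T) (N : ℕ) :
    (N % T + 1 = T → (N + 1) / T = N / T + 1 ∧ (N + 1) % T = 0) ∧
      (N % T + 1 < T → (N + 1) / T = N / T ∧ (N + 1) % T = N % T + 1) := by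
  have h := Nat.div_add_mod N T
  constructor
  · intro h1
    rw [Nat.div_mod_unique hT]
    exact ⟨by rw [mul_add]; omega, hT⟩
  · intro h1
    rw [Nat.div_mod_unique hT]
    exact ⟨by omega, h1⟩

open Classical in
theorem e_zState_mul_e (hT : 0 < T) (N : ℕ) (t : BBasis T) :
    BAlg.e F T (zState hT N) * BAlg.e F T t =
      if t = nextLetter T N then BAlg.e F T (zState hT (N + 1)) else 0 := by
  have hlt := Nat.mod_lt N hT
  obtain ⟨d1, d2⟩ := div_mod_succ hT N
  rw [BAlg.e_mul_e, nextLetter, zState]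
  simp only [dvd_succ_iff_mod hT]
  rcases t with _ | k | ⟨i, j⟩
  · by_cases h : N % T + 1 < T
    · have h' : N % T + 1 ≠ T := by omega
      obtain ⟨q1, q2⟩ := d2 h
      simp only [BAlg.table, h, h', dif_pos, if_false, if_true, zState, q1, q2]
    · have h' : N % T + 1 = T := by omega
      simp [BAlg.table, h']
  · by_cases h : N % T + 1 = T
    · obtain ⟨q1, q2⟩ := d1 h
      simp only [BAlg.table, h, true_and, if_true, BBasis.b.injEq, zState, q1, q2]
    · simp [BAlg.table, h]
  · simp only [BAlg.table]
    split_ifs <;> simp_all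

theorem e_mul_e_eq (s t : BBasis T) :
    BAlg.e F T s * BAlg.e F T t = 0 ∨ ∃ i j, BAlg.e F T s * BAlg.e F T t = BAlg.e F T (.z i j) := by
  rw [BAlg.e_mul_e]
  rcases s with _ | k | ⟨i, j⟩ <;> rcases t with _ | l | ⟨i', j'⟩ <;>
    simp only [BAlg.table, true_or]
  · split_ifs
    · exact Or.inr ⟨_, _, rfl⟩
    · exact Or.inl rfl
  · split_ifs
    · exact Or.inr ⟨_, _, rfl⟩
    · exact Or.inl rfl

theorem e_mul_e_z (s : BBasis T) (i : ℕ) (j : Fin T) :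
    BAlg.e F T s * BAlg.e F T (.z i j) = 0 := by
  rw [BAlg.e_mul_e]
  cases s <;> rfl

theorem e_mul_e_of_ne_z {s : BBasis T} (hs : ∀ i j, s ≠ .z i j) (t : BBasis T) :
    BAlg.e F T s * BAlg.e F T t = 0 := by
  rw [BAlg.e_mul_e]
  rcases s with _ | _ | ⟨i, j⟩
  · rfl
  · rfl
  · exact absurd rfl (hs i j)

variable (F) in
/-- The value in `B_T` of a word under a substitution of basis elements for the letters. -/
def value (s : ℕ → BBasis T) (w : FreeMagma ℕ) : BAlg F T :=
  FreeMagma.lift (fun x => BAlg.e F T (s x)) w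

theorem value_of (s : ℕ → BBasis T) (x : ℕ) :
    value F s (FreeMagma.of x) = BAlg.e F T (s x) := rfl

theorem value_mul (s : ℕ → BBasis T) (v w : FreeMagma ℕ) :
    value F s (v * w) = value F s v * value F s w := map_mul _ _ _

theorem value_eq (s : ℕ → BBasis T) (w : FreeMagma ℕ) :
    value F s w = 0 ∨ ∃ t, value F s w = BAlg.e F T t := by
  induction w with
  | ih1 x => exact Or.inr ⟨s x, rfl⟩
  | ih2 v w hv hw =>
    rw [value_mul]
    rcases hv with hv | ⟨t, hv⟩
    · exact Or.inl (by rw [hv, zero_mul])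
    · rcases hw with hw | ⟨t', hw⟩
      · exact Or.inl (by rw [hw, mul_zero])
      · rw [hv, hw]
        exact (e_mul_e_eq t t').imp_right fun ⟨i, j, h⟩ => ⟨_, h⟩

/-- In `B_T` every product `x (y t)` vanishes, so only left-normed words survive. -/
theorem exists_leftWord_or_value_eq_zero (T : ℕ) (w : FreeMagma ℕ) :
    (∃ g k, w = leftWord g k) ∨ ∀ s : ℕ → BBasis T, value F s w = 0 := by
  induction w with
  | ih1 x => exact Or.inl ⟨fun _ => x, 0, rfl⟩
  | ih2 v w hv _ =>
    rcases w with x | ⟨w₁, w₂⟩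
    · rcases hv with ⟨g, k, rfl⟩ | hv
      · refine Or.inl ⟨Function.update g (k + 1) x, k + 1, ?_⟩
        rw [leftWord, Function.update_self]
        congr 1
        exact leftWord_congr fun r hr => (Function.update_of_ne (by omega) _ _).symm
      · exact Or.inr fun s => by rw [value_mul, hv, zero_mul]
    · refine Or.inr fun s => ?_
      rw [value_mul, FreeMagma.mul_eq, value_mul]
      rcases value_eq (F := F) s v with hv | ⟨t, hv⟩
      · rw [hv, zero_mul]
      rcases value_eq (F := F) s w₁ with h1 | ⟨t₁, h1⟩
      · rw [h1, zero_mul, mul_zero]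
      rcases value_eq (F := F) s w₂ with h2 | ⟨t₂, h2⟩
      · rw [h2, mul_zero, mul_zero]
      rw [hv, h1, h2]
      rcases e_mul_e_eq (F := F) t₁ t₂ with h | ⟨i, j, h⟩
      · rw [h, mul_zero]
      · rw [h, e_mul_e_z]

open Classical in
theorem value_leftWord (hT : 0 < T) {s : ℕ → BBasis T} {g : ℕ → ℕ} {N : ℕ}
    (h0 : s (g 0) = zState hT N) (k : ℕ) :
    value F s (leftWord g k) =
      if ∀ r < k, s (g (r + 1)) = nextLetter T (N + r) then BAlg.e F T (zState hT (N + k))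
      else 0 := by
  induction k with
  | zero => simp [leftWord, value_of, h0]
  | succ k ih =>
    rw [leftWord, value_mul, ih, value_of]
    by_cases h : ∀ r < k, s (g (r + 1)) = nextLetter T (N + r)
    · rw [if_pos h, e_zState_mul_e]
      refine if_congr ?_ rfl rfl
      rw [Nat.forall_lt_succ_right]
      simp only [and_iff_right h]
    · rw [if_neg h, zero_mul, if_neg]
      exact fun h' => h fun r hr => h' r (by omega)

theorem value_leftWord_of_ne_z {s : ℕ → BBasis T} {g : ℕ → ℕ}
    (h0 : ∀ i j, s (g 0) ≠ .z i j) {k : ℕ} (hk : 0 < k) : value F s (leftWord g k) = 0 := by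
  induction k with
  | zero => exact absurd hk (lt_irrefl 0)
  | succ k ih =>
    rw [leftWord, value_mul]
    rcases Nat.eq_zero_or_pos k with rfl | hk
    · rw [leftWord, value_of, value_of, e_mul_e_of_ne_z h0]
    · rw [ih hk, zero_mul]

end Evaluation

/-! ### Multilinear identities of `B_T` -/

section FiberSums

universe u

open FreeNonUnitalNonAssocAlgebra (lift)

variable {F : Type u} [Field F]

/-- The restriction of a permutation of the `n` positions to a set of positions. -/
def restrictPerm {n : ℕ} (D : Finset (Fin n)) (σ : Equiv.Perm (Fin n)) : D ↪ Fin n :=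
  (Function.Embedding.subtype _).trans σ.toEmbedding

theorem restrictPerm_apply {n : ℕ} (D : Finset (Fin n)) (σ : Equiv.Perm (Fin n)) (r : D) :
    restrictPerm D σ r = σ r := rfl

variable (F) in
open Classical in
/-- For each way of filling the positions in `D` by distinct variables, the sum of the coefficients
of the left-normed multilinear words that are filled in this way. -/
def fiberSum {n : ℕ} (D : Finset (Fin n)) :
    FreeNonUnitalNonAssocAlgebra F ℕ →ₗ[F] ((D ↪ Fin n) → F) where
  toFun f ι := ∑ σ with restrictPerm D σ = ι, f.coeff (permWord σ)
  map_add' f g := by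
    ext ι
    simp [Finset.sum_add_distrib]
  map_smul' c f := by
    ext ι
    simp [Finset.mul_sum]

open Classical in
theorem fiberSum_apply {n : ℕ} (D : Finset (Fin n)) (f : FreeNonUnitalNonAssocAlgebra F ℕ)
    (ι : D ↪ Fin n) :
    fiberSum F D f ι = ∑ σ with restrictPerm D σ = ι, f.coeff (permWord σ) := rfl

theorem finrank_embedding_fun {n : ℕ} (D : Finset (Fin n)) :
    Module.finrank F ((D ↪ Fin n) → F) = n.descFactorial D.card := by
  rw [Module.finrank_pi, Fintype.card_embedding_eq, Fintype.card_fin, Fintype.card_coe]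

theorem sum_coeff_smul_eq_zero {n : ℕ} {D : Finset (Fin n)} {M : Type*} [AddCommGroup M]
    [Module F M] {f : FreeNonUnitalNonAssocAlgebra F ℕ} (hf : fiberSum F D f = 0)
    {E : Equiv.Perm (Fin n) → M}
    (hE : ∀ σ τ, restrictPerm D σ = restrictPerm D τ → E σ = E τ) :
    ∑ σ, f.coeff (permWord σ) • E σ = 0 := by
  classical
  rw [← Finset.sum_fiberwise Finset.univ (restrictPerm D)]
  refine Finset.sum_eq_zero fun ι _ => ?_
  by_cases h : ∃ τ, restrictPerm D τ = ι
  · obtain ⟨τ, rfl⟩ := h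
    have hE' : ∀ σ ∈ Finset.univ.filter fun σ => restrictPerm D σ = restrictPerm D τ,
        f.coeff (permWord σ) • E σ = f.coeff (permWord σ) • E τ := fun σ hσ => by
      rw [hE σ τ (Finset.mem_filter.1 hσ).2]
    rw [Finset.sum_congr rfl hE', ← Finset.sum_smul, ← fiberSum_apply, hf, Pi.zero_apply, zero_smul]
  · rw [Finset.filter_false_of_mem fun σ _ hσ => h ⟨σ, hσ⟩, Finset.sum_empty]

/-- The positions whose letters decide the value of a left-normed word in `B_T` when the letter in
position `0` is replaced by some `z_j^i`: position `0` and those of the letters that have to be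
replaced by some `b_k`. -/
def keyPositions (T j n : ℕ) : Finset (Fin n) :=
  Finset.univ.filter fun r => (r : ℕ) = 0 ∨ T ∣ j + r

variable {T : ℕ}

theorem lift_eq_sum_value {n : ℕ} {f : FreeNonUnitalNonAssocAlgebra F ℕ}
    (hf : f ∈ multilinear F n) (s : ℕ → BBasis T) :
    lift F (fun x => BAlg.e F T (s x)) f =
      ∑ σ : Equiv.Perm (Fin n), f.coeff (permWord σ) • value F s (permWord σ) := by
  classical
  let L : FreeNonUnitalNonAssocAlgebra F ℕ →ₗ[F] BAlg F T :=
    { toFun := fun f => ∑ σ : Equiv.Perm (Fin n), f.coeff (permWord σ) • value F s (permWord σ)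
      map_add' := fun f g => by simp [add_smul, Finset.sum_add_distrib]
      map_smul' := fun c f => by simp [Finset.smul_sum, smul_smul] }
  refine linearMap_eq_of_mem_multilinear
    (L := (lift F (fun x => BAlg.e F T (s x)) : FreeNonUnitalNonAssocAlgebra F ℕ →ₗ[F] BAlg F T))
    (L' := L) (fun w hw => ?_) hf
  have hL : L (monomial F w) = ∑ σ : Equiv.Perm (Fin n),
      (if w = permWord σ then (1 : F) else 0) • value F s (permWord σ) := by
    refine Finset.sum_congr rfl fun σ _ => ?_
    rw [monomial_eq_single, MonoidAlgebra.coeff_single, Finsupp.single_apply]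
  rw [hL, LinearMap.coe_coe, lift_monomial]
  by_cases h : ∃ τ : Equiv.Perm (Fin n), w = permWord τ
  · obtain ⟨τ, rfl⟩ := h
    simp [permWord_injective.eq_iff, value]
  · rw [Finset.sum_eq_zero fun σ _ => by rw [if_neg fun hσ => h ⟨σ, hσ⟩, zero_smul]]
    rcases exists_leftWord_or_value_eq_zero (F := F) T w with ⟨g, k, rfl⟩ | hz
    · exact absurd (exists_eq_permWord hw) h
    · exact hz s

/-- If a left-normed word has its first letter replaced by `z_j^i` and a nonzero value, then
so has every word with the same letters in the key positions. -/
theorem forall_nextLetter_of_restrictPerm_eq {m N : ℕ}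
    {s : ℕ → BBasis T} {σ τ : Equiv.Perm (Fin (m + 1))}
    (h : restrictPerm (keyPositions T (N % T) (m + 1)) σ =
      restrictPerm (keyPositions T (N % T) (m + 1)) τ)
    (hσ : ∀ r < m, s (permFun σ (r + 1)) = nextLetter T (N + r)) :
    ∀ r < m, s (permFun τ (r + 1)) = nextLetter T (N + r) := by
  have hmem : ∀ r : Fin (m + 1), r ∈ keyPositions T (N % T) (m + 1) ↔ (r : ℕ) = 0 ∨ T ∣ N + r := by
    intro r
    rw [keyPositions, Finset.mem_filter, Nat.dvd_iff_mod_eq_zero, Nat.mod_add_mod,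
      ← Nat.dvd_iff_mod_eq_zero]
    simp
  have hst : ∀ r ∈ keyPositions T (N % T) (m + 1), σ r = τ r := fun r hr =>
    DFunLike.congr_fun h ⟨r, hr⟩
  intro r hr
  have hr1 : r + 1 < m + 1 := by omega
  by_cases hd : T ∣ N + r + 1
  · have := hst ⟨r + 1, hr1⟩ ((hmem _).2 (Or.inr hd))
    rw [permFun_of_lt τ hr1, ← this, ← permFun_of_lt σ hr1]
    exact hσ r hr
  · obtain ⟨q, hq⟩ := σ.surjective (τ ⟨r + 1, hr1⟩)
    have hqD : q ∉ keyPositions T (N % T) (m + 1) := by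
      intro hqD
      have hqr : q = ⟨r + 1, hr1⟩ := τ.injective (by rw [← hst q hqD, hq])
      rw [hmem, hqr] at hqD
      rcases hqD with h0 | h0
      · exact absurd h0 (Nat.succ_ne_zero r)
      · exact hd h0
    rw [hmem, not_or] at hqD
    obtain ⟨p, hp⟩ := Nat.exists_eq_succ_of_ne_zero hqD.1
    have hpm : p + 1 < m + 1 := by
      have := q.2
      omega
    have hqp : q = ⟨p + 1, hpm⟩ := Fin.ext hp
    have hval := hσ p (by omega)
    have hpd : ¬ T ∣ N + p + 1 := by
      have := hqD.2
      rwa [hp] at this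
    rw [permFun_of_lt σ hpm, ← hqp, hq, nextLetter, if_neg hpd] at hval
    rw [permFun_of_lt τ hr1, hval, nextLetter, if_neg hd]

/-- The variable `p` in position `0` determines the state `z_j^i` in which the evaluation starts,
and among the words starting with `p` the value depends only on the letters in the key positions
for `j`. -/
theorem mem_identities_BAlg (hT : 0 < T) {n : ℕ} (hn : 0 < n)
    {f : FreeNonUnitalNonAssocAlgebra F ℕ} (hf : f ∈ multilinear F n)
    (h : ∀ j < T, fiberSum F (keyPositions T j n) f = 0) : f ∈ identities F (BAlg F T) := by
  classical
  have hspan : Submodule.span F (Set.range (BAlg.e F T)) = ⊤ :=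
    (Finsupp.basisSingleOne (R := F) (ι := BBasis T)).span_eq ▸ by
      rw [Finsupp.coe_basisSingleOne]; rfl
  refine mem_identities_of_span hf hspan fun φ hφ => ?_
  have : Nonempty (BBasis T) := ⟨.a⟩
  choose! s hs using hφ
  rw [lift_congr hf (ψ := fun x => BAlg.e F T (s x)) fun x hx => (hs x hx).symm,
    lift_eq_sum_value hf]
  -- The sum is split according to the variable in position `0`.
  have hsplit : ∀ σ : Equiv.Perm (Fin n), value F s (permWord σ) =
      ∑ p : Fin n, if σ ⟨0, hn⟩ = p then value F s (permWord σ) else 0 := by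
    intro σ
    rw [Finset.sum_ite_eq, if_pos (Finset.mem_univ _)]
  rw [Finset.sum_congr rfl fun σ _ => congrArg (f.coeff (permWord σ) • ·) (hsplit σ)]
  simp only [Finset.smul_sum]
  rw [Finset.sum_comm]
  refine Finset.sum_eq_zero fun p _ => ?_
  obtain ⟨m, rfl⟩ := Nat.exists_eq_succ_of_ne_zero hn.ne'
  have hfirst : ∀ σ : Equiv.Perm (Fin (m + 1)), permFun σ 0 = σ ⟨0, hn⟩ :=
    fun σ => permFun_of_lt σ hn
  by_cases hz : ∃ i j, s p = .z i j
  · obtain ⟨i, j, hz⟩ := hz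
    rw [z_eq_zState hT] at hz
    generalize i * T + (j : ℕ) = N at hz
    refine sum_coeff_smul_eq_zero (h (N % T) (Nat.mod_lt _ hT)) fun σ τ hστ => ?_
    have h0 : σ ⟨0, hn⟩ = τ ⟨0, hn⟩ :=
      DFunLike.congr_fun hστ ⟨⟨0, hn⟩, Finset.mem_filter.2 ⟨Finset.mem_univ _, Or.inl rfl⟩⟩
    rw [h0]
    split_ifs with hp
    · have hv : ∀ ρ : Equiv.Perm (Fin (m + 1)), ρ ⟨0, hn⟩ = p → s (permFun ρ 0) = zState hT N :=
        fun ρ hρ => by rw [hfirst, hρ, hz]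
      rw [permWord, permWord, value_leftWord hT (hv σ (h0.trans hp)),
        value_leftWord hT (hv τ hp)]
      exact if_congr ⟨forall_nextLetter_of_restrictPerm_eq hστ,
        forall_nextLetter_of_restrictPerm_eq hστ.symm⟩ rfl rfl
    · rfl
  · refine sum_coeff_smul_eq_zero (h 0 hT) fun σ τ _ => ?_
    rcases Nat.eq_zero_or_pos m with rfl | hm
    · rw [Subsingleton.elim σ τ]
    · have hzero : ∀ ρ : Equiv.Perm (Fin (m + 1)),
          (if ρ ⟨0, hn⟩ = p then value F s (permWord ρ) else 0) = 0 := by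
        intro ρ
        split_ifs with hp
        · refine value_leftWord_of_ne_z (fun i j hij => hz ⟨i, j, ?_⟩) hm
          rw [← hij, hfirst, hp]
        · rfl
      rw [hzero, hzero]

/-- For `n ≤ T` at most one of the letters `b_i` is used by a word with `n` letters, so the
multilinear identities of `B_T` of degree `n` follow from conditions that do not depend on `T`. -/
theorem mem_identities_BAlg_of_le (hT : 0 < T) {n : ℕ} (hn : 0 < n) (hnT : n ≤ T)
    {f : FreeNonUnitalNonAssocAlgebra F ℕ} (hf : f ∈ multilinear F n)
    (h : ∀ r : Fin n, fiberSum F {⟨0, hn⟩, r} f = 0) : f ∈ identities F (BAlg F T) := by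
  refine mem_identities_BAlg hT hn hf fun j hj => ?_
  suffices H : ∃ r : Fin n, keyPositions T j n = {⟨0, hn⟩, r} by
    obtain ⟨r, hr⟩ := H
    rw [hr, h r]
  by_cases hr : T < j + n ∧ 0 < j
  · refine ⟨⟨T - j, by omega⟩, ?_⟩
    ext r
    have := r.2
    simp only [keyPositions, Finset.mem_filter, Finset.mem_univ, true_and, Finset.mem_insert,
      Finset.mem_singleton, Fin.ext_iff]
    refine or_congr_right ⟨fun hd => ?_, fun hd => ⟨1, by omega⟩⟩
    obtain ⟨c, hc⟩ := hd
    have : c = 1 := by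
      rcases c with _ | _ | c
      · omega
      · rfl
      · nlinarith
    subst this
    omega
  · refine ⟨⟨0, hn⟩, ?_⟩
    ext r
    have := r.2
    simp only [keyPositions, Finset.mem_filter, Finset.mem_univ, true_and, Finset.mem_insert,
      Finset.mem_singleton, Fin.ext_iff, or_self]
    refine or_iff_left_of_imp fun hd => ?_
    by_contra hne
    have := Nat.le_of_dvd (by omega) hd
    rcases Nat.eq_zero_or_pos j with rfl | hj
    · omega
    · exact hr ⟨by omega, hj⟩

theorem card_keyPositions_le {j : ℕ} (hj : j < T) (n : ℕ) :
    (keyPositions T j n).card ≤ (n - 1) / T + 2 := by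
  have hT : 0 < T := by omega
  have hsub : keyPositions T j n ⊆ (Finset.univ.filter fun r : Fin n => (r : ℕ) = 0) ∪
      Finset.univ.filter fun r : Fin n => (r : ℕ) ≠ 0 ∧ T ∣ j + r := by
    intro r
    simp only [keyPositions, Finset.mem_filter, Finset.mem_union, Finset.mem_univ, true_and]
    tauto
  have h1 : (Finset.univ.filter fun r : Fin n => (r : ℕ) = 0).card ≤ 1 := by
    rw [Finset.card_le_one]
    intro a ha b hb
    simp only [Finset.mem_filter, Finset.mem_univ, true_and] at ha hb
    exact Fin.ext (ha.trans hb.symm)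
  have h2 : (Finset.univ.filter fun r : Fin n => (r : ℕ) ≠ 0 ∧ T ∣ j + r).card ≤
      (Finset.Ioc 0 ((n - 1) / T + 1)).card := by
    refine Finset.card_le_card_of_injOn (fun r => (j + r) / T) ?_ ?_
    · intro r hr
      simp only [Finset.coe_filter, Finset.mem_univ, true_and, Set.mem_ofPred_eq] at hr
      have := r.2
      refine Finset.mem_coe.2 (Finset.mem_Ioc.2
        ⟨Nat.div_pos (Nat.le_of_dvd (by omega) hr.2) hT, ?_⟩)
      rw [← Nat.add_div_right _ hT]
      exact Nat.div_le_div_right (by omega)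
    · intro r hr t ht h
      simp only [Finset.coe_filter, Finset.mem_univ, true_and, Set.mem_ofPred_eq] at hr ht
      have := Nat.div_mul_cancel hr.2
      rw [show (j + (r : ℕ)) / T = (j + t) / T from h, Nat.div_mul_cancel ht.2] at this
      exact Fin.ext (by omega)
  rw [Nat.card_Ioc] at h2
  exact ((Finset.card_le_card hsub).trans (Finset.card_union_le _ _)).trans
    ((Nat.add_le_add h1 h2).trans (by rw [Nat.sub_zero]; omega))

theorem le_card_keyPositions_zero (hT : 0 < T) {n : ℕ} (hn : 0 < n) :
    (n - 1) / T + 1 ≤ (keyPositions T 0 n).card := by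
  have hlt : ∀ q : Fin ((n - 1) / T + 1), (q : ℕ) * T < n := fun q => by
    have h1 := Nat.mul_le_mul_right T (Nat.lt_succ_iff.1 q.2)
    have h2 := Nat.div_mul_le_self (n - 1) T
    omega
  calc (n - 1) / T + 1 = (Finset.univ : Finset (Fin ((n - 1) / T + 1))).card := by simp
    _ ≤ _ := Finset.card_le_card_of_injOn (fun q => ⟨q * T, hlt q⟩)
      (fun q _ => by simp [keyPositions])
      (fun q _ q' _ h => Fin.ext (Nat.eq_of_mul_eq_mul_right hT (congrArg Fin.val h)))

theorem descFactorial_mono {n k l : ℕ} (hkl : k ≤ l) (hl : l ≤ n) :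
    n.descFactorial k ≤ n.descFactorial l := by
  induction l, hkl using Nat.le_induction with
  | base => exact le_rfl
  | succ l _ ih =>
    rw [Nat.descFactorial_succ]
    exact (ih (by omega)).trans (Nat.le_mul_of_pos_left _ (by omega))

/-- The substitution for which `x_{σ 0} x_{σ 1} ⋯` runs through `z_0^0, z_1^0, …`. -/
def runSubst (hT : 0 < T) {n : ℕ} (σ : Equiv.Perm (Fin n)) (x : ℕ) : BBasis T :=
  if h : x < n then
    match ((σ.symm ⟨x, h⟩ : Fin n) : ℕ) with
    | 0 => zState hT 0
    | r + 1 => nextLetter T r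
  else .a

theorem exists_perm_restrictPerm_eq {n : ℕ} {D : Finset (Fin n)} (ι : D ↪ Fin n) :
    ∃ σ, restrictPerm D σ = ι := by
  classical
  refine ⟨(Equiv.ofInjective ι ι.injective).extendSubtype, ?_⟩
  ext d
  rw [restrictPerm_apply, Equiv.extendSubtype_apply_of_mem _ _ d.2]
  rfl

/-- One word is chosen for each way of filling the key positions for `j = 0`; the substitution made
for one of these words annihilates all the others. -/
theorem descFactorial_le_codim_BAlg (hT : 0 < T) {n : ℕ} (hn : 0 < n) :
    n.descFactorial ((n - 1) / T + 1) ≤ codim F (BAlg F T) n := by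
  classical
  set D := keyPositions T 0 n
  have hDn : D.card ≤ n := by simpa using Finset.card_le_univ D
  choose σ hσ using fun ι : D ↪ Fin n => exists_perm_restrictPerm_eq ι
  refine (descFactorial_mono (le_card_keyPositions_zero hT hn) hDn).trans ?_
  have hcard : Fintype.card (D ↪ Fin n) = n.descFactorial D.card := by
    rw [Fintype.card_embedding_eq, Fintype.card_fin, Fintype.card_coe]
  rw [← hcard]
  refine card_le_codim (fun ι => monomial F (permWord (σ ι)))
    (fun ι => monomial_mem_multilinear (letters_permWord hn _)) fun c hc κ => ?_
  have key := hc fun x => BAlg.e F T (runSubst hT (σ κ) x)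
  obtain ⟨m, rfl⟩ := Nat.exists_eq_succ_of_ne_zero hn.ne'
  have hsub : ∀ τ : Equiv.Perm (Fin (m + 1)), ∀ r (h : r < m + 1),
      runSubst hT (σ κ) (permFun τ r) =
        match (((σ κ).symm (τ ⟨r, h⟩) : Fin (m + 1)) : ℕ) with
        | 0 => zState hT 0
        | r + 1 => nextLetter T r := by
    intro τ r h
    rw [permFun_of_lt τ h, runSubst, dif_pos (τ ⟨r, h⟩).2]
  have hκ : value F (runSubst hT (σ κ)) (permWord (σ κ)) = BAlg.e F T (zState hT m) := by
    rw [permWord, value_leftWord hT (N := 0) (by rw [hsub _ 0 hn]; simp), if_pos]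
    · simp
    · intro r hr
      rw [hsub _ _ (Nat.succ_lt_succ hr)]
      simp
  have hι : ∀ ι, ι ≠ κ → value F (runSubst hT (σ κ)) (permWord (σ ι)) = 0 := by
    intro ι hne
    by_contra hv
    refine hne ?_
    rcases Nat.eq_zero_or_pos m with rfl | hm
    · ext d
      rw [Subsingleton.elim (ι d) (κ d)]
    -- the first letter is the one replaced by `z_0^0`
    have hfirst : (σ κ).symm (σ ι ⟨0, hn⟩) = ⟨0, hn⟩ := by
      by_contra h0
      refine hv (value_leftWord_of_ne_z ?_ hm)
      intro i j
      rw [hsub _ 0 hn]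
      obtain ⟨q, hq⟩ := Nat.exists_eq_succ_of_ne_zero fun h => h0 (Fin.ext h)
      rw [hq]
      exact nextLetter_ne_z q i j
    have hrun : ∀ r < m, runSubst hT (σ κ) (permFun (σ ι) (r + 1)) = nextLetter T (0 + r) := by
      by_contra hcon
      refine hv ?_
      rw [permWord, value_leftWord hT (N := 0) (by rw [hsub _ 0 hn, hfirst]), Nat.succ_sub_one,
        if_neg hcon]
    rw [← hσ ι, ← hσ κ]
    ext ⟨d, hd⟩
    rw [restrictPerm_apply, restrictPerm_apply]
    suffices (σ κ).symm (σ ι d) = d by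
      rw [Equiv.symm_apply_eq] at this
      rw [this]
    rcases Nat.eq_zero_or_pos (d : ℕ) with h0 | h0
    · obtain rfl : d = ⟨0, hn⟩ := Fin.ext h0
      exact hfirst
    · obtain ⟨r, hr⟩ := Nat.exists_eq_succ_of_ne_zero h0.ne'
      have hrm : r < m := by
        have := d.2
        omega
      obtain rfl : d = ⟨r + 1, Nat.succ_lt_succ hrm⟩ := Fin.ext hr
      have hdvd : T ∣ r + 1 := by
        have := (Finset.mem_filter.1 hd).2
        simpa using this
      have h1 := hrun r hrm
      rw [hsub _ _ (Nat.succ_lt_succ hrm), zero_add] at h1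
      refine Fin.ext ?_
      generalize ((σ κ).symm (σ ι ⟨r + 1, Nat.succ_lt_succ hrm⟩) : ℕ) = q at h1 ⊢
      rcases q with _ | q
      · exact absurd h1.symm (nextLetter_ne_z r _ _)
      · simp only [nextLetter, if_pos hdvd] at h1
        by_cases hq : T ∣ q + 1
        · rw [if_pos hq] at h1
          injection h1 with h1
          have e1 := (dvd_succ_iff_mod hT q).1 hq
          have e2 := (dvd_succ_iff_mod hT r).1 hdvd
          have e3 := Nat.div_add_mod q T
          have e4 := Nat.div_add_mod r T
          rw [h1] at e3
          show q + 1 = r + 1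
          omega
        · rw [if_neg hq] at h1
          exact absurd h1 (by simp)
  simp only [map_sum, map_smul, lift_monomial] at key
  rw [Finset.sum_eq_single κ] at key
  · change c κ • value F _ _ = 0 at key
    rw [hκ] at key
    exact (smul_eq_zero.1 key).resolve_right (e_ne_zero _)
  · intro ι _ hne
    change c ι • value F _ _ = 0
    rw [hι ι hne, smul_zero]
  · exact fun h => absurd (Finset.mem_univ κ) h

end FiberSums

/-! ### Identities of `B_T ⊗ Q_N` and of the direct sum -/

section Reduction

universe u

open FreeNonUnitalNonAssocAlgebra (lift)

variable {F : Type u} [Field F] {T N : ℕ}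

/-- The pure tensor `b ⊗ q` as an element of `B_T ⊗ Q_N`. -/
def pureTensor (b : BAlg F T) (q : QAlg F N) : BQ F T N := b ⊗ₜ[F] q

theorem pureTensor_mul (b b' : BAlg F T) (q q' : QAlg F N) :
    pureTensor b q * pureTensor b' q' = pureTensor (b * b') (q * q') :=
  Algebra.TensorProduct.tmul_mul_tmul _ _ _ _

theorem lift_pureTensor_word (b : ℕ → BAlg F T) (q : ℕ → QAlg F N) (w : FreeMagma ℕ) :
    FreeMagma.lift (fun x => pureTensor (b x) (q x)) w =
      pureTensor (FreeMagma.lift b w) (FreeMagma.lift q w) := by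
  induction w with
  | ih1 x => rfl
  | ih2 v w hv hw => rw [map_mul, map_mul, map_mul, hv, hw, pureTensor_mul]

theorem coe_lift_QAlg_word (q : ℕ → QAlg F N) (w : FreeMagma ℕ) :
    ((FreeMagma.lift q w : QAlg F N) :
        Polynomial F ⧸ Ideal.span {(Polynomial.X : Polynomial F) ^ (N + 1)}) =
      ((letters w).map fun x =>
        (q x : Polynomial F ⧸ Ideal.span {(Polynomial.X : Polynomial F) ^ (N + 1)})).prod := by
  induction w with
  | ih1 x => simp
  | ih2 v w hv hw =>
    rw [map_mul, letters_mul, Multiset.map_add, Multiset.prod_add, ← hv, ← hw]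
    rfl

/-- As `Q_N` is commutative and associative, a multilinear polynomial takes the value
`f(b_0, b_1, …) ⊗ q_0 q_1 ⋯ q_{n-1}` on pure tensors `b_x ⊗ q_x`. -/
theorem lift_pureTensor {n : ℕ} (hn : 0 < n) {f : FreeNonUnitalNonAssocAlgebra F ℕ}
    (hf : f ∈ multilinear F n) (b : ℕ → BAlg F T) (q : ℕ → QAlg F N) :
    lift F (fun x => pureTensor (b x) (q x)) f =
      pureTensor (lift F b f) (FreeMagma.lift q (permWord (1 : Equiv.Perm (Fin n)))) := by
  set t := FreeMagma.lift q (permWord (1 : Equiv.Perm (Fin n))) with ht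
  let L : BAlg F T →ₗ[F] BQ F T N := (TensorProduct.mk F (BAlg F T) (QAlg F N)).flip t
  refine linearMap_eq_of_mem_multilinear
    (L := (lift F (fun x => pureTensor (b x) (q x)) :
      FreeNonUnitalNonAssocAlgebra F ℕ →ₗ[F] BQ F T N))
    (L' := L ∘ₗ (lift F b : FreeNonUnitalNonAssocAlgebra F ℕ →ₗ[F] BAlg F T))
    (fun w hw => ?_) hf
  have hwt : FreeMagma.lift q w = t := by
    refine Subtype.ext ?_
    rw [ht, coe_lift_QAlg_word, coe_lift_QAlg_word, hw, letters_permWord hn]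
  rw [LinearMap.comp_apply, LinearMap.coe_coe, LinearMap.coe_coe, lift_monomial, lift_monomial,
    lift_pureTensor_word, hwt]
  rfl

theorem mem_identities_BQ {n : ℕ} {f : FreeNonUnitalNonAssocAlgebra F ℕ}
    (hf : f ∈ multilinear F n) (h : n ≤ N → f ∈ identities F (BAlg F T)) :
    f ∈ identities F (BQ F T N) := by
  rcases Nat.eq_zero_or_pos n with rfl | hn
  · rw [multilinear_zero, Submodule.mem_bot] at hf
    rw [hf]
    exact zero_mem _
  refine mem_identities_of_span hf
    (S := {t | ∃ (b : BAlg F T) (q : QAlg F N), pureTensor b q = t})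
    (TensorProduct.span_tmul_eq_top F (BAlg F T) (QAlg F N)) fun φ hφ => ?_
  choose! b q hbq using hφ
  rw [lift_congr hf (ψ := fun x => pureTensor (b x) (q x)) fun x hx => (hbq x hx).symm,
    lift_pureTensor hn hf]
  rcases Nat.lt_or_ge N n with hN | hN
  · suffices H : FreeMagma.lift q (permWord (1 : Equiv.Perm (Fin n))) = 0 by
      rw [H]
      exact TensorProduct.tmul_zero _ _
    refine Subtype.ext ?_
    have hdvd : ∀ x, ∃ g : Polynomial F,
        (q x : Polynomial F ⧸ Ideal.span {(Polynomial.X : Polynomial F) ^ (N + 1)}) =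
          Ideal.Quotient.mk _ (Polynomial.X * g) := by
      intro x
      obtain ⟨p, hp, hpq⟩ := (q x).2
      obtain ⟨g, rfl⟩ := Polynomial.X_dvd_iff.2 hp
      exact ⟨g, hpq.symm⟩
    choose g hg using hdvd
    rw [coe_lift_QAlg_word, letters_permWord hn, Multiset.map_congr rfl fun x _ => hg x]
    change ∏ x ∈ Finset.range n, _ = _
    rw [← map_prod, Finset.prod_mul_distrib, Finset.prod_const, Finset.card_range]
    refine Ideal.Quotient.eq_zero_iff_mem.2 (Ideal.mem_span_singleton.2 ?_)
    exact (pow_dvd_pow _ hN).mul_right _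
  · rw [h hN b]
    exact TensorProduct.zero_tmul _ _

theorem mem_identities_BAlg_of_BQ {n : ℕ} {f : FreeNonUnitalNonAssocAlgebra F ℕ}
    (hf : f ∈ multilinear F n) (hN : n ≤ N) (h : f ∈ identities F (BQ F T N)) :
    f ∈ identities F (BAlg F T) := by
  rcases Nat.eq_zero_or_pos n with rfl | hn
  · rw [multilinear_zero, Submodule.mem_bot] at hf
    rw [hf]
    exact zero_mem _
  intro b
  let θ : QAlg F N := ⟨Ideal.Quotient.mk _ Polynomial.X, Polynomial.X, by simp, rfl⟩
  have key := h fun x => pureTensor (b x) θ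
  rw [lift_pureTensor hn hf b fun _ => θ] at key
  -- `θ ^ n ≠ 0` because `n ≤ N`
  have ht : FreeMagma.lift (fun _ => θ) (permWord (1 : Equiv.Perm (Fin n))) ≠ 0 := by
    intro h0
    have h1 := congrArg Subtype.val h0
    rw [coe_lift_QAlg_word, letters_permWord hn] at h1
    simp only [Multiset.map_const', Multiset.prod_replicate, Multiset.card_range, θ] at h1
    rw [← map_pow] at h1
    have h2 := Ideal.mem_span_singleton.1 (Ideal.Quotient.eq_zero_iff_mem.1 h1)
    rw [pow_dvd_pow_iff Polynomial.X_ne_zero Polynomial.not_isUnit_X] at h2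
    omega
  have : Module.Free F (QAlg F N) := Module.Free.of_divisionRing F (QAlg F N)
  obtain ⟨l, hl⟩ : ∃ l : Module.Dual F (QAlg F N), l _ ≠ 0 :=
    not_forall.1 fun hall => ht ((Module.forall_dual_apply_eq_zero_iff F _).1 hall)
  have h3 := congrArg (TensorProduct.rid F (BAlg F T) ∘ TensorProduct.map LinearMap.id l) key
  change TensorProduct.rid F _ (TensorProduct.map LinearMap.id l (_ ⊗ₜ _)) =
    TensorProduct.rid F _ (TensorProduct.map LinearMap.id l 0) at h3
  rw [TensorProduct.map_tmul, TensorProduct.rid_tmul, map_zero, map_zero] at h3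
  exact (smul_eq_zero.1 h3).resolve_left hl

/-- The projection of the direct sum to a summand. -/
def RAlg.proj (T N : ℕ → ℕ) (i : ℕ) : RAlg F T N →ₙₐ[F] BQ F (T i) (N i) where
  toFun x := x.1 i
  map_smul' _ _ := rfl
  map_zero' := rfl
  map_add' _ _ := rfl
  map_mul' _ _ := rfl

theorem RAlg.proj_surjective (T N : ℕ → ℕ) (i : ℕ) :
    Function.Surjective (RAlg.proj (F := F) T N i) := by
  intro y
  refine ⟨⟨Pi.single i y, (Set.finite_singleton i).subset fun k hk => ?_⟩, ?_⟩
  · by_contra hne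
    exact hk (Pi.single_eq_of_ne (M := fun i => BQ F (T i) (N i)) hne y)
  · exact Pi.single_eq_same (M := fun i => BQ F (T i) (N i)) i y

theorem map_lift {A B : Type*} [NonUnitalNonAssocRing A] [Module F A] [IsScalarTower F A A]
    [SMulCommClass F A A] [NonUnitalNonAssocRing B] [Module F B] [IsScalarTower F B B]
    [SMulCommClass F B B] (g : A →ₙₐ[F] B) (φ : ℕ → A) (f : FreeNonUnitalNonAssocAlgebra F ℕ) :
    g (lift F φ f) = lift F (fun x => g (φ x)) f := by
  have : g.comp (lift F φ) = lift F (fun x => g (φ x)) :=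
    FreeNonUnitalNonAssocAlgebra.hom_ext F fun x => by simp
  exact DFunLike.congr_fun this f

theorem mem_identities_RAlg_iff {T N : ℕ → ℕ} {f : FreeNonUnitalNonAssocAlgebra F ℕ} :
    f ∈ identities F (RAlg F T N) ↔ ∀ i, f ∈ identities F (BQ F (T i) (N i)) := by
  constructor
  · intro h i φ
    choose ψ hψ using fun x => RAlg.proj_surjective T N i (φ x)
    rw [← funext hψ, ← map_lift, h ψ, map_zero]
  · intro h φ
    refine Subtype.ext (funext fun i => ?_)
    change RAlg.proj T N i (lift F φ f) = 0
    rw [map_lift, h i]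

/-- In degree `n` only the summands with `n ≤ N_i` contribute to the identities of the direct sum,
and they contribute the identities of `B_{T_i}`. -/
theorem mem_identities_RAlg_iff_of_multilinear {T N : ℕ → ℕ} {n : ℕ}
    {f : FreeNonUnitalNonAssocAlgebra F ℕ} (hf : f ∈ multilinear F n) :
    f ∈ identities F (RAlg F T N) ↔ ∀ i, n ≤ N i → f ∈ identities F (BAlg F (T i)) := by
  rw [mem_identities_RAlg_iff]
  exact ⟨fun h i hi => mem_identities_BAlg_of_BQ hf hi (h i),
    fun h i => mem_identities_BQ hf (h i)⟩

end Reduction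

/-! ### Bounds for the codimensions of the direct sum -/

section Bounds

universe u

variable {F : Type u} [Field F] {T N : ℕ → ℕ}

theorem descFactorial_le_codim_RAlg {n i : ℕ} (hn : 0 < n) (hT : 0 < T i) (hN : n ≤ N i) :
    n.descFactorial ((n - 1) / T i + 1) ≤ codim F (RAlg F T N) n :=
  (descFactorial_le_codim_BAlg hT hn).trans (codim_mono fun _ hf h =>
    (mem_identities_RAlg_iff_of_multilinear hf).1 h i hN)

theorem one_le_codim_RAlg {n i : ℕ} (hn : 0 < n) (hT : 0 < T i) (hN : n ≤ N i) :
    1 ≤ codim F (RAlg F T N) n := by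
  refine le_trans (Nat.succ_le_of_lt (Nat.descFactorial_pos.2 ?_))
    (descFactorial_le_codim_RAlg (F := F) hn hT hN)
  have := Nat.div_le_self (n - 1) (T i)
  omega

theorem sum_descFactorial_pair_le {n : ℕ} (hn : 0 < n) :
    ∑ r : Fin n, n.descFactorial ({⟨0, hn⟩, r} : Finset (Fin n)).card ≤ n ^ 3 := by
  have h : ∀ r : Fin n, n.descFactorial ({⟨0, hn⟩, r} : Finset (Fin n)).card ≤ n ^ 2 := fun r =>
    (Nat.descFactorial_le_pow _ _).trans (Nat.pow_le_pow_right hn Finset.card_le_two)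
  refine (Finset.sum_le_sum fun r _ => h r).trans (le_of_eq ?_)
  rw [Finset.sum_const, Finset.card_univ, Fintype.card_fin, smul_eq_mul]
  ring

theorem codim_RAlg_le_cube {n : ℕ} (hn : 0 < n) (h : ∀ i, n ≤ N i → n ≤ T i) :
    codim F (RAlg F T N) n ≤ n ^ 3 := by
  refine (codim_le_finrank ((LinearMap.pi fun r : Fin n => fiberSum F {⟨0, hn⟩, r}) ∘ₗ
    (multilinear F n).subtype) fun f hf => ?_).trans ?_
  · rw [mem_identities_RAlg_iff_of_multilinear f.2]
    intro i hi
    exact mem_identities_BAlg_of_le (hn.trans_le (h i hi)) hn (h i hi) f.2 fun r => congrFun hf r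
  · rw [Module.finrank_pi_fintype]
    simp only [finrank_embedding_fun]
    exact sum_descFactorial_pair_le hn

theorem descFactorial_card_keyPositions_le {T j n : ℕ} (hj : j < T) (hn : 0 < n) :
    n.descFactorial (keyPositions T j n).card ≤ n * n.descFactorial ((n - 1) / T + 1) := by
  have h1 := card_keyPositions_le hj n
  have h2 : (keyPositions T j n).card ≤ n := by
    simpa using Finset.card_le_univ (keyPositions T j n)
  have h3 := Nat.div_le_self (n - 1) T
  generalize (n - 1) / T = m at *
  rcases Nat.lt_or_ge (m + 1) (keyPositions T j n).card with h | h
  · rw [show (keyPositions T j n).card = m + 1 + 1 by omega, Nat.descFactorial_succ]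
    exact Nat.mul_le_mul_right _ (Nat.sub_le _ _)
  · exact (descFactorial_mono h (by omega)).trans (Nat.le_mul_of_pos_left _ hn)

theorem codim_RAlg_le {n k : ℕ} (hn : 0 < n) (hT : 0 < T k)
    (h : ∀ i ≠ k, n ≤ N i → n ≤ T i) :
    codim F (RAlg F T N) n ≤ n ^ 3 + T k * (n * n.descFactorial ((n - 1) / T k + 1)) := by
  refine (codim_le_finrank
    (((LinearMap.pi fun r : Fin n => fiberSum F {⟨0, hn⟩, r}).prod
      (LinearMap.pi fun j : Fin (T k) => fiberSum F (keyPositions (T k) j n))) ∘ₗ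
    (multilinear F n).subtype) fun f hf => ?_).trans ?_
  · obtain ⟨hf1, hf2⟩ := Prod.mk.inj hf
    rw [mem_identities_RAlg_iff_of_multilinear f.2]
    intro i hi
    rcases eq_or_ne i k with rfl | hne
    · exact mem_identities_BAlg hT hn f.2 fun j hj => congrFun hf2 ⟨j, hj⟩
    · have hi' := h i hne hi
      exact mem_identities_BAlg_of_le (hn.trans_le hi') hn hi' f.2 fun r => congrFun hf1 r
  · rw [Module.finrank_prod, Module.finrank_pi_fintype, Module.finrank_pi_fintype]
    simp only [finrank_embedding_fun]
    refine Nat.add_le_add (sum_descFactorial_pair_le hn) ?_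
    refine (Finset.sum_le_sum fun j _ => descFactorial_card_keyPositions_le j.2 hn).trans
      (le_of_eq ?_)
    rw [Finset.sum_const, Finset.card_univ, Fintype.card_fin, smul_eq_mul]

end Bounds

/-! ### Identities of the algebra with an external unit -/

section Unitization

universe u v

open FreeNonUnitalNonAssocAlgebra (lift)

variable {F : Type u} [Field F]

/-- The number of elements of `Y` below `x`; on `Y` this is the increasing bijection onto
`{0, …, |Y| - 1}`. -/
def rank (Y : Finset ℕ) (x : ℕ) : ℕ := (Y.filter (· < x)).card

theorem rank_injOn (Y : Finset ℕ) : Set.InjOn (rank Y) Y := by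
  have hlt : ∀ x ∈ Y, ∀ y ∈ Y, x < y → rank Y x < rank Y y := by
    intro x hx y hy hxy
    refine Finset.card_lt_card ⟨fun t ht => ?_, fun h => ?_⟩
    · rw [Finset.mem_filter] at ht ⊢
      exact ⟨ht.1, ht.2.trans hxy⟩
    · exact lt_irrefl x (Finset.mem_filter.1 (h (Finset.mem_filter.2 ⟨hx, hxy⟩))).2
  intro x hx y hy h
  rcases lt_trichotomy x y with hxy | hxy | hxy
  · exact absurd h (hlt x hx y hy hxy).ne
  · exact hxy
  · exact absurd h (hlt y hy x hx hxy).ne'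

theorem map_rank (Y : Finset ℕ) : Y.val.map (rank Y) = Multiset.range Y.card := by
  have himage : Y.image (rank Y) = Finset.range Y.card := by
    refine Finset.eq_of_subset_of_card_le (fun r hr => ?_) ?_
    · obtain ⟨x, hx, rfl⟩ := Finset.mem_image.1 hr
      refine Finset.mem_range.2 (Finset.card_lt_card
        ⟨Finset.filter_subset _ _, fun h => ?_⟩)
      exact lt_irrefl x (Finset.mem_filter.1 (h hx)).2
    · rw [Finset.card_range, Finset.card_image_of_injOn (rank_injOn Y)]
  rw [← Finset.image_val_of_injOn (rank_injOn Y), himage, Finset.range_val]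

/-- The substitution of `1` for the variables outside `Y`, followed by the renumbering of the
variables in `Y`. -/
def delHom (Y : Finset ℕ) :
    FreeNonUnitalNonAssocAlgebra F ℕ →ₙₐ[F] Unitization F (FreeNonUnitalNonAssocAlgebra F ℕ) :=
  lift F fun x => if x ∈ Y then Unitization.inr (FreeNonUnitalNonAssocAlgebra.of F (rank Y x))
    else 1

theorem delHom_monomial (Y : Finset ℕ) (w : FreeMagma ℕ) :
    ((letters w).filter (· ∈ Y) = 0 ∧ delHom (F := F) Y (monomial F w) = 1) ∨
      ((letters w).filter (· ∈ Y) ≠ 0 ∧ ∃ w', delHom Y (monomial F w) =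
        Unitization.inr (monomial F w') ∧
          letters w' = ((letters w).filter (· ∈ Y)).map (rank Y)) := by
  induction w with
  | ih1 x =>
    rw [delHom, lift_monomial, FreeMagma.lift_of, letters_of, Multiset.filter_singleton]
    by_cases hx : x ∈ Y
    · right
      simp only [hx, if_true]
      exact ⟨by simp, FreeMagma.of (rank Y x), rfl, rfl⟩
    · left
      simp [hx]
  | ih2 v w hv hw =>
    rw [monomial_mul, map_mul, letters_mul, Multiset.filter_add, Multiset.map_add]
    rcases hv with ⟨hv, hv'⟩ | ⟨hv, v', hv', hlv⟩ <;> rcases hw with ⟨hw, hw'⟩ | ⟨hw, w', hw', hlw⟩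
    · exact Or.inl ⟨by rw [hv, hw, add_zero], by rw [hv', hw', one_mul]⟩
    · exact Or.inr ⟨by rwa [hv, zero_add], w', by rw [hv', hw', one_mul],
        by rw [hv, Multiset.map_zero, zero_add, hlw]⟩
    · exact Or.inr ⟨by rwa [hw, add_zero], v', by rw [hv', hw', mul_one],
        by rw [hw, Multiset.map_zero, add_zero, hlv]⟩
    · exact Or.inr ⟨by simp [hv], v' * w', by rw [hv', hw', monomial_mul, Unitization.inr_mul],
        by rw [letters_mul, hlv, hlw]⟩

theorem range_filter_mem {n : ℕ} {Y : Finset ℕ} (hY : Y ⊆ Finset.range n) :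
    (Multiset.range n).filter (· ∈ Y) = Y.val := by
  rw [← Finset.range_val, ← Finset.filter_val, Finset.filter_mem_eq_inter,
    Finset.inter_eq_right.2 hY]

/-- The nonunital part of `delHom`, as a linear map. -/
def delSnd (Y : Finset ℕ) :
    FreeNonUnitalNonAssocAlgebra F ℕ →ₗ[F] FreeNonUnitalNonAssocAlgebra F ℕ where
  toFun f := (delHom Y f).snd
  map_add' f g := by rw [map_add, Unitization.snd_add]
  map_smul' c f := by rw [map_smul, Unitization.snd_smul, RingHom.id_apply]

/-- The scalar part of `delHom`, as a linear map. -/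
def delFst (Y : Finset ℕ) : FreeNonUnitalNonAssocAlgebra F ℕ →ₗ[F] F where
  toFun f := (delHom Y f).fst
  map_add' f g := by rw [map_add, Unitization.fst_add]
  map_smul' c f := by rw [map_smul, Unitization.fst_smul, RingHom.id_apply]

theorem delSnd_apply (Y : Finset ℕ) (f : FreeNonUnitalNonAssocAlgebra F ℕ) :
    delSnd Y f = (delHom Y f).snd := rfl

theorem delFst_apply (Y : Finset ℕ) (f : FreeNonUnitalNonAssocAlgebra F ℕ) :
    delFst Y f = (delHom Y f).fst := rfl

theorem delSnd_mem_multilinear {n : ℕ} {Y : Finset ℕ} (hY : Y ⊆ Finset.range n)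
    {f : FreeNonUnitalNonAssocAlgebra F ℕ} (hf : f ∈ multilinear F n) :
    delSnd Y f ∈ multilinear F Y.card := by
  induction hf using Submodule.span_induction with
  | mem f hf =>
    obtain ⟨w, hw, rfl⟩ := hf
    rw [Set.mem_ofPred_eq] at hw
    rw [delSnd_apply]
    rcases delHom_monomial (F := F) Y w with ⟨_, h⟩ | ⟨_, w', h, hl⟩
    · rw [h, Unitization.snd_one]
      exact zero_mem _
    · rw [h, Unitization.snd_inr]
      exact monomial_mem_multilinear (by rw [hl, hw, range_filter_mem hY, map_rank])
  | zero => rw [map_zero]; exact zero_mem _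
  | add f g _ _ hf hg => rw [map_add]; exact add_mem hf hg
  | smul c f _ hf => rw [map_smul]; exact Submodule.smul_mem _ c hf

theorem delFst_eq_zero {n : ℕ} {Y : Finset ℕ} (hY : Y ⊆ Finset.range n) (hY0 : Y ≠ ∅)
    {f : FreeNonUnitalNonAssocAlgebra F ℕ} (hf : f ∈ multilinear F n) : delFst Y f = 0 := by
  refine linearMap_eq_of_mem_multilinear (L := delFst Y) (L' := 0) (fun w hw => ?_) hf
  rw [delFst_apply, LinearMap.zero_apply]
  rcases delHom_monomial (F := F) Y w with ⟨h0, _⟩ | ⟨_, w', h, _⟩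
  · rw [hw, range_filter_mem hY, Finset.val_eq_zero] at h0
    exact absurd h0 hY0
  · rw [h, Unitization.fst_inr]

variable {A : Type v} [NonUnitalNonAssocRing A] [Module F A] [IsScalarTower F A A]
  [SMulCommClass F A A]

/-- The homomorphism of the algebras with external unit induced by a homomorphism. -/
def unitizationMap {B : Type*} [NonUnitalNonAssocRing B] [Module F B] (g : B →ₙₐ[F] A) :
    Unitization F B →ₙₐ[F] Unitization F A where
  toFun x := Unitization.inl x.fst + Unitization.inr (g x.snd)
  map_smul' c x := by
    refine Unitization.ext ?_ ?_ <;> simp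
  map_zero' := by
    refine Unitization.ext ?_ ?_ <;> simp
  map_add' x y := by
    refine Unitization.ext ?_ ?_ <;> simp
  map_mul' x y := by
    refine Unitization.ext ?_ ?_ <;> simp

omit [IsScalarTower F A A] [SMulCommClass F A A] in
theorem unitizationMap_apply {B : Type*} [NonUnitalNonAssocRing B] [Module F B] (g : B →ₙₐ[F] A)
    (x : Unitization F B) :
    unitizationMap g x = Unitization.inl x.fst + Unitization.inr (g x.snd) := rfl

theorem lift_eq_unitizationMap_delHom (Y : Finset ℕ) (ψ : ℕ → A)
    (f : FreeNonUnitalNonAssocAlgebra F ℕ) :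
    lift F (fun x => if x ∈ Y then (Unitization.inr (ψ (rank Y x)) : Unitization F A) else 1) f =
      unitizationMap (lift F ψ) (delHom Y f) := by
  rw [delHom, map_lift]
  refine congrArg (fun φ : ℕ → Unitization F A => lift F φ f) (funext fun x => ?_)
  split_ifs <;> refine Unitization.ext ?_ ?_ <;> simp [unitizationMap_apply]

/-- A multilinear polynomial is an identity of `A^♯` exactly when everything that arises from it by
substituting `1` for some of the variables is an identity of `A`. -/
theorem mem_identities_unitization_iff {n : ℕ} {f : FreeNonUnitalNonAssocAlgebra F ℕ}
    (hf : f ∈ multilinear F n) :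
    f ∈ identities F (Unitization F A) ↔
      ∀ Y ⊆ Finset.range n, delFst Y f = 0 ∧ delSnd Y f ∈ identities F A := by
  constructor
  · intro h Y _
    have key : ∀ ψ : ℕ → A, unitizationMap (lift F ψ) (delHom Y f) = 0 := fun ψ => by
      rw [← lift_eq_unitizationMap_delHom, h]
    refine ⟨?_, fun ψ => ?_⟩
    · simpa [unitizationMap_apply, delFst_apply] using congrArg (fun x => x.fst) (key 0)
    · simpa [unitizationMap_apply, delSnd_apply] using congrArg (fun x => x.snd) (key ψ)
  · intro h
    have hspan : Submodule.span F (insert (1 : Unitization F A)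
        (Set.range (Unitization.inr : A → Unitization F A))) = ⊤ := by
      refine Submodule.eq_top_iff'.2 fun x => ?_
      rw [← Unitization.inl_fst_add_inr_snd_eq x]
      refine add_mem ?_ (Submodule.subset_span (Or.inr ⟨_, rfl⟩))
      have : (Unitization.inl x.fst : Unitization F A) = x.fst • 1 := by
        refine Unitization.ext ?_ ?_ <;> simp
      rw [this]
      exact Submodule.smul_mem _ _ (Submodule.subset_span (Or.inl rfl))
    refine mem_identities_of_span hf hspan fun φ hφ => ?_
    classical
    let Y := (Finset.range n).filter fun x => φ x ≠ 1
    have hφY : ∀ x ∈ Y, ∃ y : A, Unitization.inr y = φ x := fun x hx => by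
      rw [Finset.mem_filter, Finset.mem_range] at hx
      exact (hφ x hx.1).resolve_left hx.2
    choose! ψ hψ using hφY
    have hinv : ∀ x ∈ Y, Function.invFunOn (rank Y) Y (rank Y x) = x := fun x hx =>
      rank_injOn Y (Function.invFunOn_mem ⟨x, hx, rfl⟩) hx (Function.invFunOn_eq ⟨x, hx, rfl⟩)
    obtain ⟨h1, h2⟩ := h Y (Finset.filter_subset _ _)
    rw [lift_congr hf (ψ := fun x => if x ∈ Y then (Unitization.inr
      ((ψ ∘ Function.invFunOn (rank Y) Y) (rank Y x)) : Unitization F A) else 1),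
      lift_eq_unitizationMap_delHom, unitizationMap_apply, ← delFst_apply, ← delSnd_apply, h1, h2]
    · simp
    · intro x hx
      split_ifs with hxY
      · rw [Function.comp_apply, hinv x hxY, hψ x hxY]
      · by_contra hne
        exact hxY (Finset.mem_filter.2 ⟨Finset.mem_range.2 hx, hne⟩)

theorem mem_identities_unitization_of_forall {B : Type*} [NonUnitalNonAssocRing B] [Module F B]
    [IsScalarTower F B B] [SMulCommClass F B B] {n : ℕ}
    (h : ∀ k ≤ n, ∀ f ∈ multilinear F k, f ∈ identities F A → f ∈ identities F B)
    {f : FreeNonUnitalNonAssocAlgebra F ℕ} (hf : f ∈ multilinear F n)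
    (hfA : f ∈ identities F (Unitization F A)) : f ∈ identities F (Unitization F B) := by
  rw [mem_identities_unitization_iff hf] at hfA ⊢
  intro Y hY
  obtain ⟨h1, h2⟩ := hfA Y hY
  have hcard : Y.card ≤ n := by simpa using Finset.card_le_card hY
  exact ⟨h1, h _ hcard _ (delSnd_mem_multilinear hY hf) h2⟩

theorem codim_le_codim_unitization (n : ℕ) :
    codim F A n ≤ codim F (Unitization F A) n := by
  refine codim_mono fun f _ h φ => ?_
  let g : A →ₙₐ[F] Unitization F A :=
    { toFun := Unitization.inr
      map_smul' := fun c x => Unitization.inr_smul F c x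
      map_zero' := Unitization.inr_zero F
      map_add' := Unitization.inr_add F
      map_mul' := Unitization.inr_mul F }
  refine Unitization.inr_injective (R := F) ?_
  change g (lift F φ f) = _
  rw [map_lift, h, Unitization.inr_zero]

variable (F A) in
theorem exists_linearMap_ker_le_identities (n : ℕ) :
    ∃ L : multilinear F n →ₗ[F] (Fin (codim F A n) → F), ∀ f, L f = 0 →
      (f : FreeNonUnitalNonAssocAlgebra F ℕ) ∈ identities F A := by
  let Q : Submodule F (multilinear F n) := (identities F A).comap (multilinear F n).subtype
  let b : (multilinear F n ⧸ Q) ≃ₗ[F] (Fin (codim F A n) → F) :=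
    (Module.finBasis F (multilinear F n ⧸ Q)).equivFun
  refine ⟨b.toLinearMap ∘ₗ Q.mkQ, fun f hf => ?_⟩
  have h : b (Q.mkQ f) = 0 := hf
  rw [b.map_eq_zero_iff] at h
  exact (Submodule.Quotient.mk_eq_zero Q).1 h

variable (F A) in
theorem codim_unitization_le (n : ℕ) :
    codim F (Unitization F A) n ≤ 1 + ∑ k ∈ Finset.range (n + 1), n.choose k * codim F A k := by
  choose L hL using exists_linearMap_ker_le_identities F A
  refine (codim_le_finrank (M := F × (∀ Y : (Finset.range n).powerset,
    Fin (codim F A Y.1.card) → F)) ((delFst ∅ ∘ₗ (multilinear F n).subtype).prod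
    (LinearMap.pi fun Y : (Finset.range n).powerset => L Y.1.card ∘ₗ
        (delSnd Y.1).restrict fun f hf =>
          delSnd_mem_multilinear (Finset.mem_powerset.1 Y.2) hf)) fun f hf => ?_).trans ?_
  · obtain ⟨h1, h2⟩ := Prod.mk.inj hf
    rw [mem_identities_unitization_iff f.2]
    intro Y hY
    constructor
    · rcases eq_or_ne Y ∅ with rfl | hne
      · exact h1
      · exact delFst_eq_zero hY hne f.2
    · exact hL Y.card ⟨_, delSnd_mem_multilinear hY f.2⟩
        (congrFun h2 ⟨Y, Finset.mem_powerset.2 hY⟩)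
  · rw [Module.finrank_prod, Module.finrank_self, Module.finrank_pi_fintype]
    simp only [Module.finrank_fin_fun]
    rw [Finset.sum_coe_sort (Finset.range n).powerset fun Y => codim F A Y.card,
      Finset.sum_powerset_apply_card, Finset.card_range]
    simp

/-! ### A lower bound for the codimensions of `A^♯` -/

/-- The word in `x_0, …, x_{k - 1}` and `x_m` built from `x_m` by multiplying with
`x_0, …, x_{k-1}`, on the right for the variables in `U` and on the left for the others. -/
def sideWord (m : ℕ) (U : Finset ℕ) : ℕ → FreeMagma ℕ
  | 0 => FreeMagma.of m
  | k + 1 => if k ∈ U then sideWord m U k * FreeMagma.of k else FreeMagma.of k * sideWord m U k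

theorem letters_sideWord (m : ℕ) (U : Finset ℕ) (k : ℕ) :
    letters (sideWord m U k) = m ::ₘ Multiset.range k := by
  induction k with
  | zero => rfl
  | succ k ih =>
    rw [sideWord, Multiset.range_succ, Multiset.cons_swap, ← ih]
    split_ifs
    · rw [letters_mul, letters_of, add_comm, Multiset.singleton_add]
    · rw [letters_mul, letters_of, Multiset.singleton_add]

/-- The substitution of `z_0^0` for `x_m`, of `a` for the variables in `Y` and of `1` for the
others. -/
def sideSubst {T : ℕ} (hT : 0 < T) (m : ℕ) (Y : Finset ℕ) (x : ℕ) : Unitization F (BAlg F T) :=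
  if x = m then Unitization.inr (BAlg.e F T (zState hT 0))
  else if x ∈ Y then Unitization.inr (BAlg.e F T .a) else 1

theorem lift_sideWord {T : ℕ} (hT : 0 < T) {m : ℕ} (hm : m < T) (Y U : Finset ℕ) {k : ℕ}
    (hk : k ≤ m) :
    FreeMagma.lift (sideSubst (F := F) hT m Y) (sideWord m U k) =
      if ∀ x < k, x ∈ Y → x ∈ U then
        Unitization.inr (BAlg.e F T (zState hT ((Finset.range k).filter (· ∈ Y)).card)) else 0 := by
  induction k with
  | zero => simp [sideWord, sideSubst]
  | succ k ih =>
    have hkm : k ≠ m := by omega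
    have hnext : .a = nextLetter T ((Finset.range k).filter (· ∈ Y)).card := by
      rw [nextLetter, if_neg]
      intro hd
      have h1 := Nat.le_of_dvd (Nat.succ_pos _) hd
      have h2 := Finset.card_filter_le (Finset.range k) (· ∈ Y)
      rw [Finset.card_range] at h2
      omega
    have hstep := e_zState_mul_e (F := F) hT ((Finset.range k).filter (· ∈ Y)).card .a
    rw [if_pos hnext] at hstep
    rw [sideWord, Finset.range_add_one, Finset.filter_insert]
    simp only [Nat.forall_lt_succ_right]
    by_cases hY : k ∈ Y
    · have hs : sideSubst (F := F) hT m Y k = Unitization.inr (BAlg.e F T .a) := by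
        rw [sideSubst, if_neg hkm, if_pos hY]
      rw [if_pos hY, Finset.card_insert_of_notMem (by simp)]
      by_cases hU : k ∈ U
      · rw [if_pos hU, map_mul, FreeMagma.lift_of, ih (by omega), hs, ite_mul, zero_mul,
          ← Unitization.inr_mul, hstep]
        simp [hU]
      · rw [if_neg hU, map_mul, FreeMagma.lift_of, ih (by omega), hs, mul_ite, mul_zero,
          ← Unitization.inr_mul, zState, e_mul_e_z]
        simp [hU, hY]
    · have hs : sideSubst (F := F) hT m Y k = 1 := by
        rw [sideSubst, if_neg hkm, if_neg hY]
      rw [if_neg hY]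
      have hval : FreeMagma.lift (sideSubst (F := F) hT m Y)
          (if k ∈ U then sideWord m U k * FreeMagma.of k else FreeMagma.of k * sideWord m U k) =
          FreeMagma.lift (sideSubst (F := F) hT m Y) (sideWord m U k) := by
        split_ifs
        · rw [map_mul, FreeMagma.lift_of, hs, mul_one]
        · rw [map_mul, FreeMagma.lift_of, hs, one_mul]
      rw [hval, ih (by omega)]
      simp [hY]

/-- The values of the words `sideWord m U` under the substitutions `sideSubst m Y` form the
incidence matrix of the relation `Y ⊆ U`, which is invertible. -/
theorem two_pow_le_codim_unitization_BAlg {T m : ℕ} (hm : m < T) :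
    2 ^ m ≤ codim F (Unitization F (BAlg F T)) (m + 1) := by
  have hT : 0 < T := by omega
  have hcard : Fintype.card (Finset.range m).powerset = 2 ^ m := by
    rw [Fintype.card_coe, Finset.card_powerset, Finset.card_range]
  rw [← hcard]
  refine card_le_codim (fun U => monomial F (sideWord m U.1 m)) (fun U =>
    monomial_mem_multilinear (by rw [letters_sideWord, ← Multiset.range_succ])) fun c hc => ?_
  -- Downward induction on the size of `Y`: only the sets `U ⊇ Y` contribute to the value.
  suffices H : ∀ d, ∀ Y : (Finset.range m).powerset, m - Y.1.card = d → c Y = 0 from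
    fun Y => H _ Y rfl
  intro d
  induction d using Nat.strong_induction_on with
  | _ d ih =>
    intro Y hY
    have key := hc (sideSubst hT m Y.1)
    simp only [map_sum, map_smul, lift_monomial] at key
    rw [Finset.sum_eq_single Y] at key
    · rw [lift_sideWord hT hm _ _ le_rfl, if_pos fun _ _ h => h] at key
      refine (smul_eq_zero.1 key).resolve_right fun h => ?_
      exact e_ne_zero _ (Unitization.inr_injective (h.trans (Unitization.inr_zero F).symm))
    · intro U _ hne
      rw [lift_sideWord hT hm _ _ le_rfl]
      split_ifs with h
      · have hsub : Y.1 ⊂ U.1 := by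
          refine Finset.ssubset_iff_subset_ne.2 ⟨fun x hx => h x ?_ hx, fun h' =>
            hne (Subtype.ext h'.symm)⟩
          exact Finset.mem_range.1 (Finset.mem_powerset.1 Y.2 hx)
        have h1 := Finset.card_lt_card hsub
        have h2 := Finset.card_le_card (Finset.mem_powerset.1 U.2)
        rw [Finset.card_range] at h2
        rw [ih (m - U.1.card) (by omega) U rfl, zero_smul]
      · rw [smul_zero]
    · exact fun h => absurd (Finset.mem_univ Y) h

theorem two_pow_le_codim_unitization_RAlg {T N : ℕ → ℕ} {m i : ℕ} (hT : m < T i)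
    (hN : m + 1 ≤ N i) : 2 ^ m ≤ codim F (Unitization F (RAlg F T N)) (m + 1) :=
  (two_pow_le_codim_unitization_BAlg hT).trans <| codim_mono fun _ hf h =>
    mem_identities_unitization_of_forall (fun _ hk _ hg h' =>
      (mem_identities_RAlg_iff_of_multilinear hg).1 h' i (hk.trans hN)) hf h

end Unitization

/-! ### Roots of sequences with exponential bounds -/

section Roots

open Filter Topology

theorem tendsto_polynomial_root (p : ℕ) :
    Tendsto (fun n : ℕ => ENNReal.ofReal (((n : ℝ) + 1) ^ ((p : ℝ) / n))) atTop (𝓝 1) := by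
  have h1 : Tendsto (fun n : ℕ => (n : ℝ) + 1) atTop atTop :=
    tendsto_atTop_add_const_right _ _ tendsto_natCast_atTop_atTop
  have h2 := (tendsto_rpow_div_mul_add p 1 (-1) zero_ne_one).comp h1
  rw [← ENNReal.ofReal_one]
  refine (ENNReal.continuous_ofReal.tendsto 1).comp (h2.congr fun n => ?_)
  simp

theorem root_mul_pow (n p : ℕ) {x : ℝ} (hx : 0 ≤ x) :
    (((n : ℝ) + 1) ^ p * x) ^ (1 / (n : ℝ)) =
      ((n : ℝ) + 1) ^ ((p : ℝ) / n) * x ^ (1 / (n : ℝ)) := by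
  rw [Real.mul_rpow (by positivity) hx, ← Real.rpow_natCast, ← Real.rpow_mul (by positivity),
    mul_one_div]

theorem natCast_rpow_eq_ofReal (c n : ℕ) :
    (c : ℝ≥0∞) ^ (1 / (n : ℝ)) = ENNReal.ofReal ((c : ℝ) ^ (1 / (n : ℝ))) := by
  rw [← ENNReal.ofReal_rpow_of_nonneg (Nat.cast_nonneg c) (by positivity), ENNReal.ofReal_natCast]

theorem root_le_of_le {c n p : ℕ} (hn : n ≠ 0) {β : ℝ} (hβ : 0 ≤ β)
    (h : (c : ℝ) ≤ ((n : ℝ) + 1) ^ p * β ^ n) :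
    (c : ℝ≥0∞) ^ (1 / (n : ℝ)) ≤
      ENNReal.ofReal (((n : ℝ) + 1) ^ ((p : ℝ) / n)) * ENNReal.ofReal β := by
  rw [natCast_rpow_eq_ofReal, ← ENNReal.ofReal_mul (by positivity)]
  refine ENNReal.ofReal_le_ofReal ?_
  calc (c : ℝ) ^ (1 / (n : ℝ)) ≤ (((n : ℝ) + 1) ^ p * β ^ n) ^ (1 / (n : ℝ)) :=
        Real.rpow_le_rpow (Nat.cast_nonneg c) h (by positivity)
    _ = _ := by rw [root_mul_pow n p (by positivity), one_div, Real.pow_rpow_inv_natCast hβ hn]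

theorem le_root_of_le {c n p : ℕ} (hn : n ≠ 0) {β : ℝ} (hβ : 0 ≤ β)
    (h : β ^ n ≤ ((n : ℝ) + 1) ^ p * c) :
    ENNReal.ofReal β / ENNReal.ofReal (((n : ℝ) + 1) ^ ((p : ℝ) / n)) ≤
      (c : ℝ≥0∞) ^ (1 / (n : ℝ)) := by
  refine ENNReal.div_le_of_le_mul' ?_
  rw [natCast_rpow_eq_ofReal, ← ENNReal.ofReal_mul (by positivity)]
  refine ENNReal.ofReal_le_ofReal ?_
  rw [← root_mul_pow n p (Nat.cast_nonneg c)]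
  calc β = (β ^ n) ^ (1 / (n : ℝ)) := by rw [one_div, Real.pow_rpow_inv_natCast hβ hn]
    _ ≤ _ := Real.rpow_le_rpow (by positivity) h (by positivity)

theorem tendsto_upper_bound (p : ℕ) (β : ℝ) :
    Tendsto (fun n : ℕ => ENNReal.ofReal (((n : ℝ) + 1) ^ ((p : ℝ) / n)) * ENNReal.ofReal β)
      atTop (𝓝 (ENNReal.ofReal β)) := by
  have := ENNReal.Tendsto.mul_const (b := ENNReal.ofReal β) (tendsto_polynomial_root p)
    (Or.inl one_ne_zero)
  rwa [one_mul] at this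

theorem tendsto_lower_bound (p : ℕ) (β : ℝ) :
    Tendsto (fun n : ℕ => ENNReal.ofReal β / ENNReal.ofReal (((n : ℝ) + 1) ^ ((p : ℝ) / n)))
      atTop (𝓝 (ENNReal.ofReal β)) := by
  have := ENNReal.Tendsto.const_div (a := ENNReal.ofReal β) (tendsto_polynomial_root p)
    (Or.inl ENNReal.one_ne_top)
  rwa [div_one] at this

variable {c : ℕ → ℕ} {β : ℝ}

theorem limsup_root_le (hβ : 0 ≤ β) (p : ℕ)
    (h : ∀ᶠ n : ℕ in atTop, (c n : ℝ) ≤ ((n : ℝ) + 1) ^ p * β ^ n) :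
    limsup (fun n : ℕ => (c n : ℝ≥0∞) ^ (1 / (n : ℝ))) atTop ≤ ENNReal.ofReal β := by
  rw [← (tendsto_upper_bound p β).limsup_eq]
  refine limsup_le_limsup ?_
  filter_upwards [h, eventually_ne_atTop 0] with n hn hn0
  exact root_le_of_le hn0 hβ hn

theorem le_liminf_root (hβ : 0 ≤ β) (p : ℕ)
    (h : ∀ᶠ n : ℕ in atTop, β ^ n ≤ ((n : ℝ) + 1) ^ p * c n) :
    ENNReal.ofReal β ≤ liminf (fun n : ℕ => (c n : ℝ≥0∞) ^ (1 / (n : ℝ))) atTop := by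
  rw [← (tendsto_lower_bound p β).liminf_eq]
  refine liminf_le_liminf ?_
  filter_upwards [h, eventually_ne_atTop 0] with n hn hn0
  exact le_root_of_le hn0 hβ hn

theorem liminf_root_le (hβ : 0 ≤ β) (p : ℕ)
    (h : ∃ᶠ n : ℕ in atTop, (c n : ℝ) ≤ ((n : ℝ) + 1) ^ p * β ^ n) :
    liminf (fun n : ℕ => (c n : ℝ≥0∞) ^ (1 / (n : ℝ))) atTop ≤ ENNReal.ofReal β := by
  refine le_of_forall_gt_imp_ge_of_dense fun b hb => ?_
  refine liminf_le_of_frequently_le' ?_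
  refine (h.and_eventually ((eventually_ne_atTop 0).and
    ((tendsto_upper_bound p β).eventually_lt_const hb))).mono fun n hn => ?_
  exact (root_le_of_le hn.2.1 hβ hn.1).trans hn.2.2.le

theorem le_limsup_root (hβ : 0 ≤ β) (p : ℕ)
    (h : ∃ᶠ n : ℕ in atTop, β ^ n ≤ ((n : ℝ) + 1) ^ p * c n) :
    ENNReal.ofReal β ≤ limsup (fun n : ℕ => (c n : ℝ≥0∞) ^ (1 / (n : ℝ))) atTop := by
  refine le_of_forall_lt_imp_le_of_dense fun b hb => ?_
  refine le_limsup_of_frequently_le' ?_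
  refine (h.and_eventually ((eventually_ne_atTop 0).and
    ((tendsto_lower_bound p β).eventually_const_lt hb))).mono fun n hn => ?_
  exact hn.2.2.le.trans (le_root_of_le hn.2.1 hβ hn.1)

end Roots

/-! ### Choice of the parameters -/

section Parameters

open Filter

theorem descFactorial_succ_le (T : ℕ) {n : ℕ} (hn : 0 < n) :
    (n + 1).descFactorial (n / T + 1) ≤ (n + 1) * n.descFactorial ((n - 1) / T + 1) := by
  rw [Nat.succ_descFactorial_succ]
  refine Nat.mul_le_mul_left _ (descFactorial_mono ?_ ?_)
  · rcases Nat.eq_zero_or_pos T with rfl | hT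
    · simp
    · rw [← Nat.add_div_right _ hT]
      exact Nat.div_le_div_right (by omega)
  · have := Nat.div_le_self (n - 1) T
    omega

/-- For fixed `T` the codimensions of `B_T` grow faster than every exponential function. -/
theorem exists_pow_lt_descFactorial {α : ℝ} (hα : 1 < α) {T : ℕ} (hT : 2 ≤ T) :
    ∃ n, T < n ∧ α ^ n < (T * (n * n.descFactorial ((n - 1) / T + 1)) : ℕ) := by
  obtain ⟨q, hq⟩ := exists_nat_ge (α ^ (T + 1))
  have hq1 : 1 ≤ q := by
    have := (one_lt_pow₀ hα (Nat.succ_ne_zero T)).trans_le hq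
    exact_mod_cast this.le
  have hTq : T ≤ T * q := Nat.le_mul_of_pos_right _ hq1
  refine ⟨T * q + 1, by omega, ?_⟩
  rw [Nat.add_sub_cancel, Nat.mul_div_cancel_left _ (by omega : 0 < T)]
  have h1 : (q + 1) ^ (q + 1) ≤ (T * q + 1).descFactorial (q + 1) := by
    refine le_trans (Nat.pow_le_pow_left ?_ _) (Nat.pow_sub_le_descFactorial _ _)
    have : 2 * q ≤ T * q := Nat.mul_le_mul_right q hT
    omega
  have h2 : q ^ q < (q + 1) ^ (q + 1) :=
    (Nat.pow_lt_pow_left (Nat.lt_succ_self q) (by omega)).trans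
      (Nat.pow_lt_pow_right (by omega) (Nat.lt_succ_self q))
  have h3 : (T * q + 1).descFactorial (q + 1) ≤
      T * ((T * q + 1) * (T * q + 1).descFactorial (q + 1)) := by
    rw [← mul_assoc]
    exact Nat.le_mul_of_pos_left _ (by positivity)
  calc α ^ (T * q + 1) ≤ α ^ ((T + 1) * q) := pow_le_pow_right₀ hα.le (by linarith)
    _ = (α ^ (T + 1)) ^ q := pow_mul _ _ _
    _ ≤ (q : ℝ) ^ q := pow_le_pow_left₀ (by positivity) hq _
    _ < _ := by exact_mod_cast h2.trans_le (h1.trans h3)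

/-- For large `T` there is an `N` up to which the upper bound for the codimensions of `B_T` stays
below `α ^ n`, whereas in degree `N` the lower bound has reached `α ^ N` up to a polynomial
factor. -/
theorem exists_crossing {α : ℝ} (hα : 1 < α) : ∀ᶠ T : ℕ in atTop, ∃ N, T < N ∧
    (∀ n, T < n → n ≤ N → (T * (n * n.descFactorial ((n - 1) / T + 1)) : ℕ) ≤ α ^ n) ∧
    α ^ N ≤ ((N : ℝ) + 1) ^ 3 * (N.descFactorial ((N - 1) / T + 1) : ℕ) := by
  have hpoly : ∀ᶠ n : ℕ in atTop, (n : ℝ) ^ 4 / α ^ n < 1 :=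
    (tendsto_pow_const_div_const_pow_of_one_lt 4 hα).eventually_lt_const zero_lt_one
  filter_upwards [(tendsto_add_atTop_nat 1).eventually hpoly, eventually_ge_atTop 2]
    with T hT hT2
  rw [div_lt_one (by positivity)] at hT
  have hex := exists_pow_lt_descFactorial hα hT2
  classical
  obtain ⟨h1, h2⟩ := Nat.find_spec hex
  have hmin : ∀ n, T < n → n < Nat.find hex →
      (T * (n * n.descFactorial ((n - 1) / T + 1)) : ℕ) ≤ α ^ n := fun n hn hlt =>
    not_lt.1 fun h => Nat.find_min hex hlt ⟨hn, h⟩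
  generalize Nat.find hex = M at h1 h2 hmin
  obtain ⟨N, rfl⟩ := Nat.exists_eq_succ_of_ne_zero (by omega : M ≠ 0)
  have hN : T < N := by
    by_contra hcon
    obtain rfl : N = T := by omega
    refine absurd h2 (not_lt.2 (le_trans ?_ hT.le))
    rw [Nat.succ_sub_one, Nat.div_self (by omega)]
    have : N * (N.succ * N.succ.descFactorial (1 + 1)) ≤ (N + 1) ^ 4 := by
      calc N * (N.succ * N.succ.descFactorial (1 + 1))
          ≤ (N + 1) * ((N + 1) * (N + 1) ^ 2) :=
            Nat.mul_le_mul (Nat.le_succ N) (Nat.mul_le_mul_left _ (Nat.descFactorial_le_pow _ _))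
        _ = (N + 1) ^ 4 := by ring
    exact_mod_cast this
  refine ⟨N, hN, fun n hn hle => hmin n hn (by omega), ?_⟩
  have h3 : T * ((N + 1) * (N + 1).descFactorial (N / T + 1)) ≤
      (N + 1) ^ 3 * N.descFactorial ((N - 1) / T + 1) := by
    calc T * ((N + 1) * (N + 1).descFactorial (N / T + 1))
        ≤ (N + 1) * ((N + 1) * ((N + 1) * N.descFactorial ((N - 1) / T + 1))) :=
          Nat.mul_le_mul (by omega) (Nat.mul_le_mul_left _ (descFactorial_succ_le T (by omega)))
      _ = _ := by ring
  calc α ^ N ≤ α ^ (N + 1) := pow_le_pow_right₀ hα.le (Nat.le_succ N)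
    _ ≤ (T * ((N + 1) * (N + 1).descFactorial (N / T + 1)) : ℕ) := by
      rw [Nat.succ_sub_one] at h2
      exact h2.le
    _ ≤ ((N + 1) ^ 3 * N.descFactorial ((N - 1) / T + 1) : ℕ) := by exact_mod_cast h3
    _ = _ := by push_cast; ring

/-- The properties of the parameters from which the exponents are computed. -/
structure GoodParameters (α : ℝ) (T N : ℕ → ℕ) : Prop where
  two_le : ∀ i, 2 ≤ T i
  lt : ∀ i, T i < N i
  lt_succ : ∀ i, N i < T (i + 1)
  pow_le : ∀ i, α ^ N i ≤ T (i + 1)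
  upper : ∀ i n, T i < n → n ≤ N i →
    (T i * (n * n.descFactorial ((n - 1) / T i + 1)) : ℕ) ≤ α ^ n
  lower : ∀ i, α ^ N i ≤ ((N i : ℝ) + 1) ^ 3 * ((N i).descFactorial ((N i - 1) / T i + 1) : ℕ)

theorem exists_goodParameters {α : ℝ} (hα : 1 < α) : ∃ T N, GoodParameters α T N := by
  have hstep : ∀ M : ℕ, ∃ P : ℕ × ℕ, M < P.1 ∧ 2 ≤ P.1 ∧ α ^ M ≤ P.1 ∧ P.1 < P.2 ∧
      (∀ n, P.1 < n → n ≤ P.2 →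
        (P.1 * (n * n.descFactorial ((n - 1) / P.1 + 1)) : ℕ) ≤ α ^ n) ∧
      α ^ P.2 ≤ ((P.2 : ℝ) + 1) ^ 3 * (P.2.descFactorial ((P.2 - 1) / P.1 + 1) : ℕ) := by
    intro M
    obtain ⟨T, ⟨N, h1, h2, h3⟩, h4, h5, h6⟩ := ((exists_crossing hα).and
      ((eventually_gt_atTop M).and ((eventually_ge_atTop 2).and
        (tendsto_natCast_atTop_atTop.eventually_ge_atTop (α ^ M))))).exists
    exact ⟨(T, N), h4, h5, h6, h1, h2, h3⟩
  choose P h1 h2 h3 h4 h5 h6 using hstep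
  let M : ℕ → ℕ := fun k => Nat.rec 0 (fun _ m => (P m).2) k
  exact ⟨fun k => (P (M k)).1, fun k => (P (M k)).2,
    { two_le := fun i => h2 _
      lt := fun i => h4 _
      lt_succ := fun i => h1 (M (i + 1))
      pow_le := fun i => h3 (M (i + 1))
      upper := fun i => h5 _
      lower := fun i => h6 _ }⟩

namespace GoodParameters

universe u

variable {F : Type u} [Field F] {α : ℝ} {T N : ℕ → ℕ}

theorem strictMono (h : GoodParameters α T N) : StrictMono N :=
  strictMono_nat_of_lt_succ fun i => (h.lt_succ i).trans (h.lt (i + 1))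

theorem N_lt_T (h : GoodParameters α T N) {i k : ℕ} (hik : i < k) : N i < T k := by
  obtain ⟨l, rfl⟩ := Nat.exists_eq_succ_of_ne_zero (by omega : k ≠ 0)
  exact (h.strictMono.monotone (Nat.lt_succ_iff.1 hik)).trans_lt (h.lt_succ l)

theorem le_T_succ (h : GoodParameters α T N) (i : ℕ) : i ≤ T (i + 1) :=
  (h.strictMono.le_apply.trans_lt (h.lt_succ i)).le

theorem codim_le (h : GoodParameters α T N) (hα : 1 < α) (n : ℕ) :
    (codim F (RAlg F T N) n : ℝ) ≤ (n : ℝ) ^ 3 + α ^ n := by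
  rcases Nat.eq_zero_or_pos n with rfl | hn
  · simp [codim_zero]
  have hex : ∃ k, n ≤ N k := ⟨n, h.strictMono.le_apply⟩
  classical
  have hk := Nat.find_spec hex
  have hmin : ∀ i < Nat.find hex, N i < n := fun i hi => not_le.1 (Nat.find_min hex hi)
  generalize Nat.find hex = k at hk hmin
  have hne : ∀ i ≠ k, n ≤ N i → n ≤ T i := by
    intro i hik hi
    rcases lt_or_gt_of_ne hik with hlt | hgt
    · exact absurd hi (not_le.2 (hmin i hlt))
    · exact hk.trans (h.N_lt_T hgt).le
  rcases Nat.lt_or_ge (T k) n with hT | hT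
  · have h1 := codim_RAlg_le (F := F) hn (by have := h.two_le k; omega) hne
    have h2 := h.upper k n hT hk
    have h3 : (codim F (RAlg F T N) n : ℝ) ≤
        (n : ℝ) ^ 3 + (T k * (n * n.descFactorial ((n - 1) / T k + 1)) : ℕ) := by
      exact_mod_cast h1
    linarith
  · have h1 : codim F (RAlg F T N) n ≤ n ^ 3 := codim_RAlg_le_cube hn fun i hi => by
      rcases eq_or_ne i k with rfl | hik
      · exact hT
      · exact hne i hik hi
    have h2 : (codim F (RAlg F T N) n : ℝ) ≤ (n : ℝ) ^ 3 := by exact_mod_cast h1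
    have : 0 ≤ α ^ n := by positivity
    linarith

theorem codim_le_of_le (h : GoodParameters α T N) (hα : 1 < α) {i j : ℕ} (hj : j ≤ T (i + 1)) :
    codim F (RAlg F T N) j ≤ 2 * T (i + 1) ^ 3 := by
  have hpow : j ^ 3 ≤ T (i + 1) ^ 3 := Nat.pow_le_pow_left hj 3
  rcases Nat.lt_or_ge (N i) j with hN | hN
  · refine le_trans (codim_RAlg_le_cube (by omega) fun k hk => ?_)
      (hpow.trans (Nat.le_mul_of_pos_left _ two_pos))
    have hik : i < k := by
      by_contra hcon
      have := h.strictMono.monotone (not_lt.1 hcon)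
      omega
    rcases Nat.lt_or_ge (i + 1) k with hlt | hge
    · exact hj.trans ((h.lt _).trans (h.N_lt_T hlt)).le
    · obtain rfl : k = i + 1 := by omega
      exact hj
  · have h1 := h.codim_le (F := F) hα j
    have h2 : α ^ j ≤ α ^ N i := pow_le_pow_right₀ hα.le hN
    have h3 := h.pow_le i
    have h4 : (T (i + 1) : ℝ) ≤ (T (i + 1) : ℝ) ^ 3 := by
      exact_mod_cast Nat.le_self_pow (by norm_num) _
    have h5 : (j : ℝ) ^ 3 ≤ (T (i + 1) : ℝ) ^ 3 := by exact_mod_cast hpow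
    have h6 : (codim F (RAlg F T N) j : ℝ) ≤ 2 * (T (i + 1) : ℝ) ^ 3 := by linarith
    exact_mod_cast h6

theorem lowerExp_RAlg (h : GoodParameters α T N) (hα : 1 < α) :
    lowerExp F (RAlg F T N) = 1 := by
  refine le_antisymm ?_ ?_
  · rw [← ENNReal.ofReal_one]
    refine liminf_root_le zero_le_one 4 (frequently_atTop.2 fun a => ⟨T (a + 1), h.le_T_succ a, ?_⟩)
    have h1 : (codim F (RAlg F T N) (T (a + 1)) : ℝ) ≤ 2 * (T (a + 1) : ℝ) ^ 3 := by
      exact_mod_cast h.codim_le_of_le (F := F) hα le_rfl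
    refine h1.trans ?_
    have h2 : (0 : ℝ) ≤ T (a + 1) := Nat.cast_nonneg _
    rw [one_pow, mul_one]
    ring_nf
    nlinarith [pow_nonneg h2 2, pow_nonneg h2 3, pow_nonneg h2 4]
  · rw [← ENNReal.ofReal_one]
    refine le_liminf_root zero_le_one 0 ?_
    filter_upwards [eventually_gt_atTop 0] with n hn
    rw [one_pow, pow_zero, one_mul]
    exact_mod_cast one_le_codim_RAlg (F := F) hn (by have := h.two_le n; omega)
      h.strictMono.le_apply

theorem upperExp_RAlg (h : GoodParameters α T N) (hα : 1 < α) :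
    upperExp F (RAlg F T N) = ENNReal.ofReal α := by
  refine le_antisymm ?_ ?_
  · refine limsup_root_le (by linarith) 3 (Eventually.of_forall fun n => ?_)
    refine (h.codim_le hα n).trans ?_
    have h1 : 1 ≤ α ^ n := one_le_pow₀ hα.le
    have h2 : (0 : ℝ) ≤ n := Nat.cast_nonneg n
    have h3 : (n : ℝ) ^ 3 + 1 ≤ ((n : ℝ) + 1) ^ 3 := by nlinarith [pow_nonneg h2 2]
    nlinarith [pow_nonneg h2 3]
  · refine le_limsup_root (by linarith) 3
      (frequently_atTop.2 fun a => ⟨N a, h.strictMono.le_apply, (h.lower a).trans ?_⟩)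
    refine mul_le_mul_of_nonneg_left ?_ (by positivity)
    have h1 := h.two_le a
    have h2 := h.lt a
    exact_mod_cast descFactorial_le_codim_RAlg (F := F) (by omega) (by omega) le_rfl

theorem lowerExp_unitization (h : GoodParameters α T N) (hα : 1 < α) :
    lowerExp F (Unitization F (RAlg F T N)) = 2 := by
  rw [show (2 : ℝ≥0∞) = ENNReal.ofReal 2 by simp]
  refine le_antisymm ?_ ?_
  · refine liminf_root_le zero_le_two 4 (frequently_atTop.2 fun a => ⟨T (a + 1), h.le_T_succ a, ?_⟩)
    have h1 : codim F (Unitization F (RAlg F T N)) (T (a + 1)) ≤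
        1 + 2 ^ T (a + 1) * (2 * T (a + 1) ^ 3) := by
      refine (codim_unitization_le F _ _).trans (Nat.add_le_add_left ?_ 1)
      rw [← Nat.sum_range_choose, Finset.sum_mul]
      refine Finset.sum_le_sum fun k hk => Nat.mul_le_mul_left _ (h.codim_le_of_le hα ?_)
      exact Nat.lt_succ_iff.1 (Finset.mem_range.1 hk)
    generalize T (a + 1) = n at h1
    have h2 : 1 ≤ 2 ^ n := Nat.one_le_two_pow
    have h3 : 1 + 2 ^ n * (2 * n ^ 3) ≤ (n + 1) ^ 4 * 2 ^ n := by
      have : 2 * n ^ 3 + 1 ≤ (n + 1) ^ 4 := by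
        ring_nf
        omega
      nlinarith
    exact_mod_cast h1.trans h3
  · refine le_liminf_root zero_le_two 1 ?_
    filter_upwards [eventually_gt_atTop 0] with n hn
    obtain ⟨m, rfl⟩ := Nat.exists_eq_succ_of_ne_zero hn.ne'
    have h1 : m + 1 ≤ T (m + 2) := h.le_T_succ (m + 1)
    have h2 := two_pow_le_codim_unitization_RAlg (F := F) (T := T) (N := N) h1
      (h1.trans (h.lt _).le)
    have h3 : 2 ^ (m + 1) ≤ (m + 1 + 1) ^ 1 * codim F (Unitization F (RAlg F T N)) (m + 1) := by
      rw [pow_succ, mul_comm, pow_one]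
      exact Nat.mul_le_mul (by omega) h2
    exact_mod_cast h3

theorem le_upperExp_unitization (h : GoodParameters α T N) (hα : 1 < α) :
    ENNReal.ofReal α ≤ upperExp F (Unitization F (RAlg F T N)) := by
  rw [← h.upperExp_RAlg (F := F) hα]
  refine limsup_le_limsup (Eventually.of_forall fun n => ?_)
  refine ENNReal.rpow_le_rpow ?_ (by positivity)
  exact_mod_cast codim_le_codim_unitization n

theorem upperExp_unitization_le (h : GoodParameters α T N) (hα : 1 < α) :
    upperExp F (Unitization F (RAlg F T N)) ≤ ENNReal.ofReal (α + 1) := by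
  refine limsup_root_le (by linarith) 4 ?_
  filter_upwards [eventually_gt_atTop 0] with n hn
  have h1 : (codim F (Unitization F (RAlg F T N)) n : ℝ) ≤
      1 + ∑ k ∈ Finset.range (n + 1), (n.choose k : ℝ) * codim F (RAlg F T N) k := by
    exact_mod_cast codim_unitization_le F (RAlg F T N) n
  have h2 : ∑ k ∈ Finset.range (n + 1), (n.choose k : ℝ) * codim F (RAlg F T N) k ≤
      ((n : ℝ) + 1) ^ 3 * (α + 1) ^ n := by
    rw [add_pow α, Finset.mul_sum]
    refine Finset.sum_le_sum fun k hk => ?_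
    have hk : (k : ℝ) ≤ n := by exact_mod_cast Nat.lt_succ_iff.1 (Finset.mem_range.1 hk)
    have hk0 : (0 : ℝ) ≤ k := Nat.cast_nonneg k
    have h3 : (k : ℝ) ^ 3 + 1 ≤ ((k : ℝ) + 1) ^ 3 := by nlinarith [pow_nonneg hk0 2]
    have h4 : ((k : ℝ) + 1) ^ 3 ≤ ((n : ℝ) + 1) ^ 3 :=
      pow_le_pow_left₀ (by positivity) (by linarith) 3
    have h5 : 1 ≤ α ^ k := one_le_pow₀ hα.le
    have h6 : (codim F (RAlg F T N) k : ℝ) ≤ ((n : ℝ) + 1) ^ 3 * α ^ k := by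
      refine (h.codim_le hα k).trans ?_
      nlinarith [pow_nonneg hk0 3]
    calc (n.choose k : ℝ) * codim F (RAlg F T N) k
        ≤ (n.choose k : ℝ) * (((n : ℝ) + 1) ^ 3 * α ^ k) :=
          mul_le_mul_of_nonneg_left h6 (Nat.cast_nonneg _)
      _ = _ := by rw [one_pow]; ring
  have hn1 : (1 : ℝ) ≤ n := by exact_mod_cast hn
  have h7 : 1 ≤ ((n : ℝ) + 1) ^ 3 * (α + 1) ^ n :=
    one_le_mul_of_one_le_of_one_le (one_le_pow₀ (by linarith)) (one_le_pow₀ (by linarith))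
  calc (codim F (Unitization F (RAlg F T N)) n : ℝ)
      ≤ 2 * (((n : ℝ) + 1) ^ 3 * (α + 1) ^ n) := by linarith
    _ ≤ ((n : ℝ) + 1) * (((n : ℝ) + 1) ^ 3 * (α + 1) ^ n) :=
        mul_le_mul_of_nonneg_right (by linarith) (by linarith)
    _ = _ := by ring

end GoodParameters

end Parameters

end PIExp

end

theorem theorem1 {F : Type*} [Field F] [CharZero F] (α : ℝ) (hα : 1 < α) :
    ∃ T N : ℕ → ℕ, (∀ i, 2 ≤ T i ∧ T i < N i ∧ N i < T (i + 1)) ∧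
      PIExp.lowerExp F (PIExp.RAlg F T N) = 1 ∧
      PIExp.upperExp F (PIExp.RAlg F T N) = ENNReal.ofReal α ∧
      PIExp.lowerExp F (Unitization F (PIExp.RAlg F T N)) = 2 ∧
      ENNReal.ofReal α ≤ PIExp.upperExp F (Unitization F (PIExp.RAlg F T N)) ∧
      PIExp.upperExp F (Unitization F (PIExp.RAlg F T N)) ≤ ENNReal.ofReal (α + 1) := by
  obtain ⟨T, N, h⟩ := PIExp.exists_goodParameters hα
  exact ⟨T, N, fun i => ⟨h.two_le i, h.lt i, h.lt_succ i⟩, h.lowerExp_RAlg hα,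
    h.upperExp_RAlg hα, h.lowerExp_unitization hα, h.le_upperExp_unitization hα,
    h.upperExp_unitization_le hα⟩
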